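/- **Setting.** For $r\times r$ matrix-valued measurable $\mathbf f:D\to\mathbb C^{r\times r}$ on a measurable set $D\subset\mathbb R^t$ with $0<\mu_t(D)<\infty$, a sequence $\{A_n\}_n$ of square matrices, $A_n$ of size $d_n$, is *spectrally distributed as* $\mathbf f$ if for every continuous compactly supported $F:\mathbb C\to\mathbb C$ $$\lim_{n\to\infty}\frac1{d_n}\sum_{i=1}^{d_n}F(\lambda_i(A_n))=\frac1{\mu_t(D)}\int_D\frac1r\sum_{i=1}^{r}F(\lambda_i(\mathbf f(\mathbf x)))\,d\mathbf x ,$$ eigenvalues being counted with algebraic multiplicity. For $\mathbf f:[-\pi,\pi]^2\to\mathbb C^{r\times r}$ with integrable entries let $\hat{\mathbf f}_{\mathbf k}=\frac1{(2\pi)^2}\int_{[-\pi,\pi]^2}\mathbf f(\boldsymbol\theta)e^{-\mathrm i(k_1\theta_1+k_2\theta_2)}d\boldsymbol\theta$ and let $T_n(\mathbf f)$ be the two-level block Toeplitz matrix $[\hat{\mathbf f}_{\mathbf i-\mathbf j}]_{\mathbf i,\mathbf j\in\{1,\dots,n\}^2}$ of size $rn^2$. Let $\Omega=(0,1)^2$.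 Divide $\overline\Omega$ into $n\times n$ equal squares, and each square into two triangles by its diagonal from the upper left to the lower right corner (Friedrichs–Keller triangulation). Let $V_n$ be the space of continuous functions on $\overline\Omega$ that vanish on $\partial\Omega$ and are polynomials of degree at most $3$ on each triangle, and let $\varphi_p$ be its Lagrangian nodal basis, $\varphi_p(\text{node } q)=\delta_{pq}$, associated with the internal nodes $\left(\frac a{3n},\frac b{3n}\right)$, $1\le a,b\le 3n-1$. Let $A_n(1,\Omega,\mathbb P_3)=\left[\int_\Omega\nabla\varphi_q\cdot\nabla\varphi_p\right]_{p,q}$ be the stiffness matrix, of size $(3n-1)^2$. With $e_j=e^{\mathrm i\theta_j}$ and $\bar e_j=e^{-\mathrm i\theta_j}$, let $\mathbf f_{\mathbb P_3}(\theta_1,\theta_2)$ be the $9\times9$ matrix $$\begin{bmatrix} \alpha&-\frac\alpha4&-\frac\alpha4e_1&-\frac\alpha4&0&0&-\frac\alpha4e_2&0&0\\ -\frac\alpha4&\beta&-\frac\beta4+\frac\beta{20}e_1&-\frac\beta5&-\frac\alpha4&\frac\beta{20}(1+e_1)&\frac\beta{20}(1+e_2)&\frac\beta{20}-\frac\beta4e_2&f_{29}\\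 -\frac\alpha4\bar e_1&-\frac\beta4+\frac\beta{20}\bar e_1&\beta&\frac\beta{20}(1+\bar e_1)&0&-\frac\beta2&0&0&f_{39}\\ -\frac\alpha4&-\frac\beta5&\frac\beta{20}(1+e_1)&\beta&-\frac\alpha4&\frac\beta{20}-\frac\beta4e_1&-\frac\beta4+\frac\beta{20}e_2&\frac\beta{20}(1+e_2)&f_{49}\\ 0&-\frac\alpha4&0&-\frac\alpha4&\alpha&-\frac\alpha4&0&-\frac\alpha4&0\\ 0&\frac\beta{20}(1+\bar e_1)&-\frac\beta2&\frac\beta{20}-\frac\beta4\bar e_1&-\frac\alpha4&\beta&0&0&f_{69}\\ -\frac\alpha4\bar e_2&\frac\beta{20}(1+\bar e_2)&0&-\frac\beta4+\frac\beta{20}\bar e_2&0&0&\beta&-\frac\beta2&f_{79}\\ 0&\frac\beta{20}-\frac\beta4\bar e_2&0&\frac\beta{20}(1+\bar e_2)&-\frac\alpha4&0&-\frac\beta2&\beta&f_{89}\\ 0&\overline{f_{29}}&\overline{f_{39}}&\overline{f_{49}}&0&\overline{f_{69}}&\overline{f_{79}}&\overline{f_{89}}&f_{99} \end{bmatrix}$$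 where $f_{29}=f_{49}=-\gamma(1-e_1)(1-e_2)$, $f_{39}=\delta-\frac\gamma2e_1-\varepsilon e_2-\frac\gamma2\bar e_1e_2$, $f_{69}=-\varepsilon-\frac\gamma2e_1+\delta e_2-\frac\gamma2\bar e_1e_2$, $f_{79}=\delta-\varepsilon e_1-\frac\gamma2e_1\bar e_2-\frac\gamma2e_2$, $f_{89}=-\varepsilon+\delta e_1-\frac\gamma2e_1\bar e_2-\frac\gamma2e_2$, $f_{99}=\zeta-2\eta(\cos\theta_1+\cos\theta_2)$ and $\alpha=\frac{81}{10}$, $\beta=\frac{27}4$, $\gamma=\frac3{40}$, $\delta=\frac{57}{80}$, $\varepsilon=\frac{21}{16}$, $\zeta=\frac{17}5$, $\eta=\frac7{40}$. **Proposition.** The matrix $\mathbf f_{\mathbb P_3}(\theta_1,\theta_2)$ is Hermitian for all $(\theta_1,\theta_2)$, and the two matrix-sequences $\{T_n(\mathbf f_{\mathbb P_3})\}_n$ and $\{A_n(1,\Omega,\mathbb P_3)\}_n$ are both spectrally distributed as $\mathbf f_{\mathbb P_3}$ on $[-\pi,\pi]^2$. -/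

import Mathlib

open MeasureTheory Filter Topology

namespace FEM

/-! ### Spectral distribution of matrix-sequences -/

/-- The sum of `F` over all eigenvalues of a square complex matrix, counted with algebraic
multiplicity. -/
noncomputable def eigSum {m : Type*} [Fintype m] [DecidableEq m]
    (A : Matrix m m ℂ) (F : ℂ → ℂ) : ℂ :=
  (A.charpoly.roots.map F).sum

/-- The matrix-sequence `A` is spectrally distributed as the `r × r` matrix-valued function `f`
on the set `D`: here `D` is measurable of positive finite measure, `f` is measurable on `D`, and for
every continuous compactly supported `F : ℂ → ℂ` the mean of `F` over the eigenvalues of `A n`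
converges to the mean over `D` of the mean of `F` over the eigenvalues of `f`. -/
structure SpectrallyDistributed {m : ℕ → Type*} [∀ n, Fintype (m n)] [∀ n, DecidableEq (m n)]
    (A : ∀ n, Matrix (m n) (m n) ℂ) {α : Type*} [MeasureSpace α] (D : Set α) {r : ℕ}
    (f : α → Matrix (Fin r) (Fin r) ℂ) : Prop where
  measurableSet : MeasurableSet D
  measure_pos : 0 < volume D
  measure_lt_top : volume D < ⊤
  aemeasurable : ∀ i j, AEMeasurable (fun x => f x i j) (volume.restrict D)
  tendsto : ∀ F : ℂ → ℂ, Continuous F → HasCompactSupport F →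
    Tendsto (fun n => (Fintype.card (m n) : ℂ)⁻¹ * eigSum (A n) F) atTop
      (𝓝 (((volume D).toReal : ℂ)⁻¹ * ∫ x in D, eigSum (f x) F / (r : ℂ)))

/-! ### Two-level block Toeplitz matrices -/

/-- The square `[-π, π]²`. -/
def fourierSquare : Set (ℝ × ℝ) :=
  Set.Icc (-Real.pi) Real.pi ×ˢ Set.Icc (-Real.pi) Real.pi

/-- The Fourier coefficient of index `(k₁, k₂)` of a matrix-valued function on `[-π, π]²`,
computed componentwise. -/
noncomputable def fourierCoeff₂ {r : ℕ} (f : ℝ × ℝ → Matrix (Fin r) (Fin r) ℂ) (k₁ k₂ : ℤ) :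
    Matrix (Fin r) (Fin r) ℂ :=
  Matrix.of fun a b => (1 / (2 * (Real.pi : ℂ)) ^ 2) * ∫ θ in fourierSquare,
    f θ a b * Complex.exp (-Complex.I * ((k₁ : ℂ) * (θ.1 : ℂ) + (k₂ : ℂ) * (θ.2 : ℂ)))

/-- The two-level block Toeplitz matrix of level sizes `(n₁, n₂)` generated by `f`: its block at
position `(i, j)`, for two-indices `i` and `j`, is the Fourier coefficient of index `i - j`. -/
noncomputable def toeplitz {r : ℕ} (f : ℝ × ℝ → Matrix (Fin r) (Fin r) ℂ) (n₁ n₂ : ℕ) :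
    Matrix ((Fin n₁ × Fin n₂) × Fin r) ((Fin n₁ × Fin n₂) × Fin r) ℂ :=
  Matrix.of fun i j => fourierCoeff₂ f (((i.1.1 : ℕ) : ℤ) - ((j.1.1 : ℕ) : ℤ))
    (((i.1.2 : ℕ) : ℤ) - ((j.1.2 : ℕ) : ℤ)) i.2 j.2

/-! ### Cubic Lagrangian finite elements on Friedrichs–Keller triangulations of the unit square -/

/-- The open unit square `(0, 1)²`. -/
def unitSquare : Set (ℝ × ℝ) := Set.Ioo 0 1 ×ˢ Set.Ioo 0 1

/-- The triangle with the right angle in the lower left corner of the cell `(c, d)` of the uniform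
grid of step `1 / n`. -/
def lowerTriangle (n c d : ℕ) : Set (ℝ × ℝ) :=
  convexHull ℝ {((c : ℝ) / n, (d : ℝ) / n), (((c : ℝ) + 1) / n, (d : ℝ) / n),
    ((c : ℝ) / n, ((d : ℝ) + 1) / n)}

/-- The triangle with the right angle in the upper right corner of the cell `(c, d)`. -/
def upperTriangle (n c d : ℕ) : Set (ℝ × ℝ) :=
  convexHull ℝ {(((c : ℝ) + 1) / n, ((d : ℝ) + 1) / n), ((c : ℝ) / n, ((d : ℝ) + 1) / n),
    (((c : ℝ) + 1) / n, (d : ℝ) / n)}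

/-- The Friedrichs–Keller triangulation of the closed unit square with `n` intervals per side. -/
def friedrichsKeller (n : ℕ) : Set (Set (ℝ × ℝ)) :=
  {K | ∃ c d : ℕ, c < n ∧ d < n ∧ (K = lowerTriangle n c d ∨ K = upperTriangle n c d)}

/-- The Lagrangian finite element space of degree `k`: continuous functions which are polynomials of
degree at most `k` on each triangle and vanish on the boundary of the square. They are extended by
zero outside the square, so that each element of the space is one function on the plane. -/
def lagrangeSpace (k n : ℕ) : Set (ℝ × ℝ → ℝ) :=
  {φ | Continuous φ ∧ (∀ x, x ∉ unitSquare → φ x = 0) ∧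
    ∀ K ∈ friedrichsKeller n, ∃ P : MvPolynomial (Fin 2) ℝ, P.totalDegree ≤ k ∧
      ∀ x ∈ K, φ x = MvPolynomial.eval ![x.1, x.2] P}

/-- Indices of the internal nodes for degree `3`. -/
abbrev NodeIndex (n : ℕ) : Type := Fin (3 * n - 1) × Fin (3 * n - 1)

/-- The internal nodes are the points `(a / (3 n), b / (3 n))` with `1 ≤ a, b ≤ 3 n - 1`. -/
noncomputable def node (n : ℕ) (p : NodeIndex n) : ℝ × ℝ :=
  (((p.1 : ℕ) + 1 : ℝ) / (3 * n), ((p.2 : ℕ) + 1 : ℝ) / (3 * n))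

/-- The piecewise linear hat function of the vertex `(V.1 / n, V.2 / n)` of the mesh. On a triangle
with this vertex it is the corresponding barycentric coordinate; on the others it is zero. -/
noncomputable def hat (n : ℕ) (V : ℕ × ℕ) (x : ℝ × ℝ) : ℝ :=
  max 0 (1 - max (max |n * x.1 - V.1| |n * x.2 - V.2|) |(n * x.1 - V.1) + (n * x.2 - V.2)|)

/-- Three times the value of the hat function of `V` at the point `(a / (3 n), b / (3 n))`; the
subtraction of natural numbers is meant to be truncated at zero. -/
def nodeWeight (a b : ℕ) (V : ℕ × ℕ) : ℕ :=
  3 - max (max ((a : ℤ) - 3 * V.1).natAbs ((b : ℤ) - 3 * V.2).natAbs)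
    (((a : ℤ) - 3 * V.1) + ((b : ℤ) - 3 * V.2)).natAbs

/-- The polynomial of degree `m` in `t` with zeros `0, …, m - 1` and value `1` at `m`. -/
noncomputable def lagrangeFactor (m : ℕ) (t : ℝ) : ℝ :=
  ∏ l ∈ Finset.range m, (t - l) / ((m : ℝ) - l)

/-- The formula, in terms of the barycentric coordinates, of the cubic nodal basis function of the
node `p`. -/
noncomputable def cubicBasisFun (n : ℕ) (p : NodeIndex n) (x : ℝ × ℝ) : ℝ :=
  ∏ V ∈ Finset.range (n + 1) ×ˢ Finset.range (n + 1),
    lagrangeFactor (nodeWeight ((p.1 : ℕ) + 1) ((p.2 : ℕ) + 1) V) (3 * hat n V x)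

theorem lagrangeFactor_zero (t : ℝ) : lagrangeFactor 0 t = 1 := by
  simp [lagrangeFactor]

theorem lagrangeFactor_self (m : ℕ) : lagrangeFactor m m = 1 := by
  unfold lagrangeFactor
  refine Finset.prod_eq_one fun l hl => ?_
  have : (l : ℝ) < m := by exact_mod_cast Finset.mem_range.1 hl
  exact div_self (by linarith)

theorem lagrangeFactor_of_lt {m l : ℕ} (h : l < m) : lagrangeFactor m l = 0 := by
  unfold lagrangeFactor
  exact Finset.prod_eq_zero (Finset.mem_range.2 h) (by simp)

theorem continuous_hat (n : ℕ) (V : ℕ × ℕ) : Continuous (hat n V) := by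
  unfold hat
  fun_prop

theorem continuous_cubicBasisFun (n : ℕ) (p : NodeIndex n) : Continuous (cubicBasisFun n p) := by
  unfold cubicBasisFun lagrangeFactor
  have := continuous_hat n
  refine continuous_finsetProd _ fun V _ => continuous_finsetProd _ fun l _ => ?_
  have := continuous_hat n V
  fun_prop

theorem three_mul_hat_node {n : ℕ} (q : NodeIndex n) (V : ℕ × ℕ) :
    3 * hat n V (node n q) = nodeWeight ((q.1 : ℕ) + 1) ((q.2 : ℕ) + 1) V := by
  have hn : (n : ℝ) ≠ 0 := by
    have := q.1.2
    have : n ≠ 0 := by omega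
    exact_mod_cast this
  have key : ∀ s t : ℤ, ((3 - max (max s.natAbs t.natAbs) (s + t).natAbs : ℕ) : ℝ) =
      3 * max 0 (1 - max (max |(s : ℝ) / 3| |(t : ℝ) / 3|) |(s : ℝ) / 3 + (t : ℝ) / 3|) := by
    intro s t
    have e : (s : ℝ) / 3 + (t : ℝ) / 3 = ((s + t : ℤ) : ℝ) / 3 := by push_cast; ring
    rw [e]
    simp only [abs_div, ← Int.cast_abs, Int.abs_eq_natAbs]
    generalize s.natAbs = A
    generalize t.natAbs = B
    generalize (s + t).natAbs = C
    have h3 : |(3 : ℝ)| = 3 := abs_of_pos (by norm_num)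
    rw [h3, max_div_div_right (by norm_num), max_div_div_right (by norm_num)]
    push_cast
    have : max (max (A : ℝ) B) C = ((max (max A B) C : ℕ) : ℝ) := by push_cast; rfl
    rw [this]
    generalize max (max A B) C = M
    rcases le_total M 3 with h | h
    · have h' : (M : ℝ) ≤ 3 := by exact_mod_cast h
      rw [Nat.cast_sub h, max_eq_right (by linarith)]
      push_cast; ring
    · have h' : (3 : ℝ) ≤ M := by exact_mod_cast h
      rw [Nat.sub_eq_zero_of_le h, max_eq_left (by linarith)]
      simp
  unfold nodeWeight hat node
  rw [key]
  have e1 : ∀ a v : ℕ, (n : ℝ) * (((a : ℝ) + 1) / (3 * n)) - v =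
      (((((a + 1 : ℕ) : ℤ) - 3 * v : ℤ)) : ℝ) / 3 := by
    intro a v
    push_cast
    field_simp
  simp only [e1]

theorem le_nodeWeight {a b k : ℕ} {V : ℕ × ℕ} (hk : k ≤ nodeWeight a b V) :
    k = 0 ∨ (a + k ≤ 3 * V.1 + 3 ∧ 3 * V.1 + k ≤ a + 3 ∧ b + k ≤ 3 * V.2 + 3 ∧
      3 * V.2 + k ≤ b + 3 ∧ a + b + k ≤ 3 * V.1 + 3 * V.2 + 3 ∧
      3 * V.1 + 3 * V.2 + k ≤ a + b + 3) := by
  unfold nodeWeight at hk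
  generalize V.1 = i at *
  generalize V.2 = j at *
  have h1 := le_max_left (max ((a : ℤ) - 3 * i).natAbs ((b : ℤ) - 3 * j).natAbs)
    (((a : ℤ) - 3 * i) + ((b : ℤ) - 3 * j)).natAbs
  have h2 := le_max_right (max ((a : ℤ) - 3 * i).natAbs ((b : ℤ) - 3 * j).natAbs)
    (((a : ℤ) - 3 * i) + ((b : ℤ) - 3 * j)).natAbs
  have h3 := le_max_left ((a : ℤ) - 3 * i).natAbs ((b : ℤ) - 3 * j).natAbs
  have h4 := le_max_right ((a : ℤ) - 3 * i).natAbs ((b : ℤ) - 3 * j).natAbs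
  generalize max (max ((a : ℤ) - 3 * i).natAbs ((b : ℤ) - 3 * j).natAbs)
    (((a : ℤ) - 3 * i) + ((b : ℤ) - 3 * j)).natAbs = M at *
  generalize max ((a : ℤ) - 3 * i).natAbs ((b : ℤ) - 3 * j).natAbs = M' at *
  by_cases h0 : k = 0
  · exact Or.inl h0
  · right
    have hM : M + k ≤ 3 := by omega
    have g1 : ((a : ℤ) - 3 * i).natAbs + k ≤ 3 := by omega
    have g2 : ((b : ℤ) - 3 * j).natAbs + k ≤ 3 := by omega
    have g3 : (((a : ℤ) - 3 * i) + ((b : ℤ) - 3 * j)).natAbs + k ≤ 3 := by omega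
    refine ⟨?_, ?_, ?_, ?_, ?_, ?_⟩ <;> omega

theorem cubicBasisFun_node {n : ℕ} (p q : NodeIndex n) :
    cubicBasisFun n p (node n q) = if q = p then 1 else 0 := by
  unfold cubicBasisFun
  simp only [three_mul_hat_node]
  split_ifs with h
  · subst h
    exact Finset.prod_eq_one fun V _ => lagrangeFactor_self _
  · suffices H : ∃ V ∈ Finset.range (n + 1) ×ˢ Finset.range (n + 1),
        nodeWeight ((q.1 : ℕ) + 1) ((q.2 : ℕ) + 1) V <
          nodeWeight ((p.1 : ℕ) + 1) ((p.2 : ℕ) + 1) V by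
      obtain ⟨V, hV, hlt⟩ := H
      exact Finset.prod_eq_zero hV (lagrangeFactor_of_lt hlt)
    have h1 := p.1.2
    have h2 := p.2.2
    have hne : ((q.1 : ℕ) + 1) ≠ ((p.1 : ℕ) + 1) ∨ ((q.2 : ℕ) + 1) ≠ ((p.2 : ℕ) + 1) := by
      by_contra hc
      push Not at hc
      exact h (Prod.ext (Fin.ext (by omega)) (Fin.ext (by omega)))
    generalize ((p.1 : ℕ)) = a at *
    generalize ((p.2 : ℕ)) = b at *
    generalize ((q.1 : ℕ)) = a' at *
    generalize ((q.2 : ℕ)) = b' at *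
    by_contra hc
    push Not at hc
    have hc' : ∀ i j : ℕ, i ≤ n → j ≤ n →
        nodeWeight (a + 1) (b + 1) (i, j) ≤ nodeWeight (a' + 1) (b' + 1) (i, j) :=
      fun i j hi hj => hc (i, j) (by simp [hi, hj])
    obtain ⟨c, v, hv, ha⟩ : ∃ c v, v < 3 ∧ a + 1 = 3 * c + v :=
      ⟨(a + 1) / 3, (a + 1) % 3, by omega, by omega⟩
    obtain ⟨d, w, hw, hb⟩ : ∃ d w, w < 3 ∧ b + 1 = 3 * d + w :=
      ⟨(b + 1) / 3, (b + 1) % 3, by omega, by omega⟩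
    have A := hc' c d (by omega) (by omega)
    have B := hc' (c + 1) d (by omega) (by omega)
    have C := hc' c (d + 1) (by omega) (by omega)
    have D := hc' (c + 1) (d + 1) (by omega) (by omega)
    rw [ha, hb] at A B C D hne
    clear hc hc' h
    by_cases hs : v + w ≤ 3
    · have A' := le_nodeWeight (k := 3 - v - w) (le_trans (by unfold nodeWeight; simp only; omega) A)
      have B' := le_nodeWeight (k := v) (le_trans (by unfold nodeWeight; simp only; omega) B)
      have C' := le_nodeWeight (k := w) (le_trans (by unfold nodeWeight; simp only; omega) C)
      clear A B C D
      simp only at A' B' C'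
      omega
    · have hv2 : v = 2 := by omega
      have hw2 : w = 2 := by omega
      subst hv2 hw2
      have B' := le_nodeWeight (k := 1) (le_trans (by unfold nodeWeight; simp only; omega) B)
      have C' := le_nodeWeight (k := 1) (le_trans (by unfold nodeWeight; simp only; omega) C)
      have D' := le_nodeWeight (k := 1) (le_trans (by unfold nodeWeight; simp only; omega) D)
      clear A B C D
      simp only at B' C' D'
      omega

theorem cubicBasisFun_eq_zero {n : ℕ} (p : NodeIndex n) {x : ℝ × ℝ} {V : ℕ × ℕ}
    (h1 : V.1 ≤ n) (h2 : V.2 ≤ n) (hV : nodeWeight ((p.1 : ℕ) + 1) ((p.2 : ℕ) + 1) V ≠ 0)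
    (hx : hat n V x = 0) : cubicBasisFun n p x = 0 := by
  unfold cubicBasisFun
  refine Finset.prod_eq_zero (i := V) (by simp [h1, h2]) ?_
  rw [hx]
  have := lagrangeFactor_of_lt (Nat.pos_of_ne_zero hV)
  simpa using this

theorem hat_eq_zero {n : ℕ} {V : ℕ × ℕ} {x : ℝ × ℝ}
    (h : 1 ≤ |n * x.1 - V.1| ∨ 1 ≤ |n * x.2 - V.2| ∨
      1 ≤ |(n * x.1 - V.1) + (n * x.2 - V.2)|) : hat n V x = 0 := by
  unfold hat
  refine max_eq_left ?_
  simp only [sub_nonpos, le_max_iff]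
  tauto

theorem hat_eq {n : ℕ} {V : ℕ × ℕ} {x : ℝ × ℝ} {t : ℝ} (h0 : 0 ≤ t)
    (h1 : |n * x.1 - V.1| ≤ 1 - t) (h2 : |n * x.2 - V.2| ≤ 1 - t)
    (h3 : |(n * x.1 - V.1) + (n * x.2 - V.2)| ≤ 1 - t)
    (h : 1 - t ≤ |n * x.1 - V.1| ∨ 1 - t ≤ |n * x.2 - V.2| ∨
      1 - t ≤ |(n * x.1 - V.1) + (n * x.2 - V.2)|) : hat n V x = t := by
  have : max (max |n * x.1 - V.1| |n * x.2 - V.2|) |(n * x.1 - V.1) + (n * x.2 - V.2)| = 1 - t := by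
    refine le_antisymm (max_le (max_le h1 h2) h3) ?_
    simp only [le_max_iff]
    tauto
  unfold hat
  rw [this, sub_sub_cancel, max_eq_right h0]

theorem cubicBasisFun_boundary {n : ℕ} (p : NodeIndex n) {x : ℝ × ℝ} (hx : x ∉ unitSquare) :
    cubicBasisFun n p x = 0 := by
  have h1 := p.1.2
  have h2 := p.2.2
  have key : ∀ P : ℕ × ℕ → Prop,
      (∀ V, P V → hat n V x = 0) →
      (∃ i j : ℕ, i ≤ n ∧ j ≤ n ∧ P (i, j) ∧
        nodeWeight ((p.1 : ℕ) + 1) ((p.2 : ℕ) + 1) (i, j) ≠ 0) → cubicBasisFun n p x = 0 := by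
    rintro P hP ⟨i, j, hi, hj, hPij, hw⟩
    exact cubicBasisFun_eq_zero p (V := (i, j)) hi hj hw (hP _ hPij)
  have hn : (0 : ℝ) ≤ n := Nat.cast_nonneg n
  have cases4 : x.1 ≤ 0 ∨ 1 ≤ x.1 ∨ x.2 ≤ 0 ∨ 1 ≤ x.2 := by
    by_contra hc
    push Not at hc
    exact hx ⟨⟨hc.1, hc.2.1⟩, ⟨hc.2.2.1, hc.2.2.2⟩⟩
  clear hx
  generalize ((p.1 : ℕ)) = a at *
  generalize ((p.2 : ℕ)) = b at *
  obtain ⟨c, v, hv, ha⟩ : ∃ c v, v < 3 ∧ a + 1 = 3 * c + v :=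
    ⟨(a + 1) / 3, (a + 1) % 3, by omega, by omega⟩
  obtain ⟨d, w, hw, hb⟩ : ∃ d w, w < 3 ∧ b + 1 = 3 * d + w :=
    ⟨(b + 1) / 3, (b + 1) % 3, by omega, by omega⟩
  rw [ha, hb] at key
  unfold nodeWeight at key
  rcases cases4 with h | h | h | h
  · refine key (fun V => 1 ≤ V.1) (fun V hV => hat_eq_zero (Or.inl ?_)) ?_
    · have : (1 : ℝ) ≤ V.1 := by exact_mod_cast hV
      rw [abs_of_nonpos] <;> nlinarith
    · by_cases hv0 : v = 0
      · exact ⟨c, d, by omega, by omega, by simp only; omega, by simp only; omega⟩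
      · by_cases hs : v + w ≤ 3
        · exact ⟨c + 1, d, by omega, by omega, by simp only; omega, by simp only; omega⟩
        · exact ⟨c + 1, d + 1, by omega, by omega, by simp only; omega, by simp only; omega⟩
  · refine key (fun V => V.1 + 1 ≤ n) (fun V hV => hat_eq_zero (Or.inl ?_)) ?_
    · have : ((V.1 : ℕ) : ℝ) + 1 ≤ n := by exact_mod_cast hV
      rw [abs_of_nonneg] <;> nlinarith
    · by_cases hs : v + w < 3
      · exact ⟨c, d, by omega, by omega, by simp only; omega, by simp only; omega⟩
      · exact ⟨c, d + 1, by omega, by omega, by simp only; omega, by simp only; omega⟩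
  · refine key (fun V => 1 ≤ V.2) (fun V hV => hat_eq_zero (Or.inr (Or.inl ?_))) ?_
    · have : (1 : ℝ) ≤ V.2 := by exact_mod_cast hV
      rw [abs_of_nonpos] <;> nlinarith
    · by_cases hv0 : w = 0
      · exact ⟨c, d, by omega, by omega, by simp only; omega, by simp only; omega⟩
      · by_cases hs : v + w ≤ 3
        · exact ⟨c, d + 1, by omega, by omega, by simp only; omega, by simp only; omega⟩
        · exact ⟨c + 1, d + 1, by omega, by omega, by simp only; omega, by simp only; omega⟩
  · refine key (fun V => V.2 + 1 ≤ n) (fun V hV => hat_eq_zero (Or.inr (Or.inl ?_))) ?_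
    · have : ((V.2 : ℕ) : ℝ) + 1 ≤ n := by exact_mod_cast hV
      rw [abs_of_nonneg] <;> nlinarith
    · by_cases hs : v + w < 3
      · exact ⟨c, d, by omega, by omega, by simp only; omega, by simp only; omega⟩
      · exact ⟨c + 1, d, by omega, by omega, by simp only; omega, by simp only; omega⟩

theorem mem_lowerTriangle {n c d : ℕ} (hn : n ≠ 0) {x : ℝ × ℝ} (hx : x ∈ lowerTriangle n c d) :
    0 ≤ n * x.1 - c ∧ 0 ≤ n * x.2 - d ∧ (n * x.1 - c) + (n * x.2 - d) ≤ 1 := by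
  have hn' : (n : ℝ) ≠ 0 := by exact_mod_cast hn
  have hc : Convex ℝ {x : ℝ × ℝ | 0 ≤ n * x.1 - c ∧ 0 ≤ n * x.2 - d ∧
      (n * x.1 - c) + (n * x.2 - d) ≤ 1} := by
    rintro y ⟨hy1, hy2, hy3⟩ z ⟨hz1, hz2, hz3⟩ s t hs ht hst
    have : s = 1 - t := by linarith
    subst this
    simp only [Set.mem_ofPred_eq, Prod.fst_add, Prod.snd_add, Prod.smul_fst, Prod.smul_snd,
      smul_eq_mul]
    refine ⟨?_, ?_, ?_⟩ <;> nlinarith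
  refine convexHull_min ?_ hc hx
  rintro y (rfl | rfl | rfl) <;> simp only [Set.mem_ofPred_eq] <;>
    simp only [mul_div_cancel₀ _ hn'] <;> refine ⟨?_, ?_, ?_⟩ <;> linarith

theorem mem_upperTriangle {n c d : ℕ} (hn : n ≠ 0) {x : ℝ × ℝ} (hx : x ∈ upperTriangle n c d) :
    n * x.1 - c ≤ 1 ∧ n * x.2 - d ≤ 1 ∧ 1 ≤ (n * x.1 - c) + (n * x.2 - d) := by
  have hn' : (n : ℝ) ≠ 0 := by exact_mod_cast hn
  have hc : Convex ℝ {x : ℝ × ℝ | n * x.1 - c ≤ 1 ∧ n * x.2 - d ≤ 1 ∧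
      1 ≤ (n * x.1 - c) + (n * x.2 - d)} := by
    rintro y ⟨hy1, hy2, hy3⟩ z ⟨hz1, hz2, hz3⟩ s t hs ht hst
    have : s = 1 - t := by linarith
    subst this
    simp only [Set.mem_ofPred_eq, Prod.fst_add, Prod.snd_add, Prod.smul_fst, Prod.smul_snd,
      smul_eq_mul]
    refine ⟨?_, ?_, ?_⟩ <;> nlinarith
  refine convexHull_min ?_ hc hx
  rintro y (rfl | rfl | rfl) <;> simp only [Set.mem_ofPred_eq] <;>
    simp only [mul_div_cancel₀ _ hn'] <;> refine ⟨?_, ?_, ?_⟩ <;> linarith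

theorem exists_polynomial {n : ℕ} (p : NodeIndex n) (K : Set (ℝ × ℝ)) (S : Finset (ℕ × ℕ))
    (hS : S ⊆ Finset.range (n + 1) ×ˢ Finset.range (n + 1))
    (haff : ∀ V ∈ S, ∃ α β γ : ℝ, ∀ x ∈ K, hat n V x = α * x.1 + β * x.2 + γ)
    (hzero : ∀ V, V ∉ S → ∀ x ∈ K, hat n V x = 0)
    (hsum : ∑ V ∈ S, nodeWeight ((p.1 : ℕ) + 1) ((p.2 : ℕ) + 1) V ≤ 3) :
    ∃ P : MvPolynomial (Fin 2) ℝ, P.totalDegree ≤ 3 ∧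
      ∀ x ∈ K, cubicBasisFun n p x = MvPolynomial.eval ![x.1, x.2] P := by
  classical
  by_cases hex : ∃ V ∈ Finset.range (n + 1) ×ˢ Finset.range (n + 1), V ∉ S ∧
      nodeWeight ((p.1 : ℕ) + 1) ((p.2 : ℕ) + 1) V ≠ 0
  · obtain ⟨V, hV, hVS, hw⟩ := hex
    simp only [Finset.mem_product, Finset.mem_range, Nat.lt_succ_iff] at hV
    refine ⟨0, by simp, fun x hx => ?_⟩
    rw [cubicBasisFun_eq_zero p hV.1 hV.2 hw (hzero V hVS x hx), map_zero]
  · push Not at hex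
    have hex' : ∀ V ∈ Finset.range (n + 1) ×ˢ Finset.range (n + 1), V ∉ S →
        nodeWeight ((p.1 : ℕ) + 1) ((p.2 : ℕ) + 1) V = 0 := hex
    choose! α β γ h using haff
    let L : ℕ × ℕ → MvPolynomial (Fin 2) ℝ := fun V =>
      MvPolynomial.C (α V) * MvPolynomial.X 0 + MvPolynomial.C (β V) * MvPolynomial.X 1 +
        MvPolynomial.C (γ V)
    have hL : ∀ V, (L V).totalDegree ≤ 1 := by
      intro V
      refine (MvPolynomial.totalDegree_add _ _).trans (max_le
        ((MvPolynomial.totalDegree_add _ _).trans (max_le ?_ ?_)) ?_)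
      · exact (MvPolynomial.totalDegree_mul _ _).trans (by simp)
      · exact (MvPolynomial.totalDegree_mul _ _).trans (by simp)
      · simp
    refine ⟨∏ V ∈ S, ∏ l ∈ Finset.range (nodeWeight ((p.1 : ℕ) + 1) ((p.2 : ℕ) + 1) V),
      MvPolynomial.C (((nodeWeight ((p.1 : ℕ) + 1) ((p.2 : ℕ) + 1) V : ℝ) - l)⁻¹) *
        (MvPolynomial.C 3 * L V - MvPolynomial.C (l : ℝ)), ?_, ?_⟩
    · refine (MvPolynomial.totalDegree_finsetProd _ _).trans (le_trans ?_ hsum)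
      refine Finset.sum_le_sum fun V _ => ?_
      refine (MvPolynomial.totalDegree_finsetProd _ _).trans ?_
      refine (Finset.sum_le_card_nsmul _ _ 1 fun l _ => ?_).trans (by simp)
      refine (MvPolynomial.totalDegree_mul _ _).trans ?_
      rw [MvPolynomial.totalDegree_C, zero_add]
      refine (MvPolynomial.totalDegree_sub_C_le _ _).trans ?_
      refine (MvPolynomial.totalDegree_mul _ _).trans ?_
      rw [MvPolynomial.totalDegree_C, zero_add]
      exact hL V
    · intro x hx
      unfold cubicBasisFun
      rw [← Finset.prod_subset hS fun V hV hVS => by rw [hex' V hV hVS, lagrangeFactor_zero]]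
      rw [map_prod]
      refine Finset.prod_congr rfl fun V hV => ?_
      rw [map_prod]
      unfold lagrangeFactor
      refine Finset.prod_congr rfl fun l _ => ?_
      rw [h V hV x hx]
      simp [L]
      ring

theorem exists_polynomial_lower {n c d : ℕ} (hc : c < n) (hd : d < n) (p : NodeIndex n) :
    ∃ P : MvPolynomial (Fin 2) ℝ, P.totalDegree ≤ 3 ∧
      ∀ x ∈ lowerTriangle n c d, cubicBasisFun n p x = MvPolynomial.eval ![x.1, x.2] P := by
  have hn : n ≠ 0 := by omega
  refine exists_polynomial p _ {(c, d), (c + 1, d), (c, d + 1)} ?_ ?_ ?_ ?_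
  · intro V hV
    simp only [Finset.mem_insert, Finset.mem_singleton] at hV
    rcases hV with rfl | rfl | rfl <;> simp <;> omega
  · intro V hV
    simp only [Finset.mem_insert, Finset.mem_singleton] at hV
    rcases hV with rfl | rfl | rfl
    · refine ⟨-n, -n, 1 + c + d, fun x hx => ?_⟩
      obtain ⟨h1, h2, h3⟩ := mem_lowerTriangle hn hx
      refine hat_eq ?_ (abs_le.2 ⟨?_, ?_⟩) (abs_le.2 ⟨?_, ?_⟩) (abs_le.2 ⟨?_, ?_⟩)
        (Or.inr (Or.inr (le_abs.2 ?_))) <;> push_cast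
      any_goals linarith
      left
      linarith
    · refine ⟨n, 0, -c, fun x hx => ?_⟩
      obtain ⟨h1, h2, h3⟩ := mem_lowerTriangle hn hx
      refine hat_eq ?_ (abs_le.2 ⟨?_, ?_⟩) (abs_le.2 ⟨?_, ?_⟩) (abs_le.2 ⟨?_, ?_⟩)
        (Or.inl (le_abs.2 ?_)) <;> push_cast
      any_goals linarith
      right
      linarith
    · refine ⟨0, n, -d, fun x hx => ?_⟩
      obtain ⟨h1, h2, h3⟩ := mem_lowerTriangle hn hx
      refine hat_eq ?_ (abs_le.2 ⟨?_, ?_⟩) (abs_le.2 ⟨?_, ?_⟩) (abs_le.2 ⟨?_, ?_⟩)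
        (Or.inr (Or.inl (le_abs.2 ?_))) <;> push_cast
      any_goals linarith
      right
      linarith
  · rintro ⟨i, j⟩ hV x hx
    simp only [Finset.mem_insert, Finset.mem_singleton, Prod.mk.injEq] at hV
    obtain ⟨h1, h2, h3⟩ := mem_lowerTriangle hn hx
    apply hat_eq_zero
    simp only [le_abs]
    have hcase : i + 1 ≤ c ∨ c + 2 ≤ i ∨ j + 1 ≤ d ∨ d + 2 ≤ j ∨ c + d + 2 ≤ i + j := by omega
    rcases hcase with h | h | h | h | h
    · have : (i : ℝ) + 1 ≤ c := by exact_mod_cast h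
      left; left; linarith
    · have : (c : ℝ) + 2 ≤ i := by exact_mod_cast h
      left; right; linarith
    · have : (j : ℝ) + 1 ≤ d := by exact_mod_cast h
      right; left; left; linarith
    · have : (d : ℝ) + 2 ≤ j := by exact_mod_cast h
      right; left; right; linarith
    · have : (c : ℝ) + d + 2 ≤ i + j := by exact_mod_cast h
      right; right; right; linarith
  · rw [Finset.sum_insert (by simp), Finset.sum_insert (by simp), Finset.sum_singleton]
    have h0 := le_nodeWeight (le_refl (nodeWeight ((p.1 : ℕ) + 1) ((p.2 : ℕ) + 1) (c, d)))
    have h1 := le_nodeWeight (le_refl (nodeWeight ((p.1 : ℕ) + 1) ((p.2 : ℕ) + 1) (c + 1, d)))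
    have h2 := le_nodeWeight (le_refl (nodeWeight ((p.1 : ℕ) + 1) ((p.2 : ℕ) + 1) (c, d + 1)))
    generalize nodeWeight ((p.1 : ℕ) + 1) ((p.2 : ℕ) + 1) (c, d) = w0 at *
    generalize nodeWeight ((p.1 : ℕ) + 1) ((p.2 : ℕ) + 1) (c + 1, d) = w1 at *
    generalize nodeWeight ((p.1 : ℕ) + 1) ((p.2 : ℕ) + 1) (c, d + 1) = w2 at *
    simp only at h0 h1 h2
    omega

theorem exists_polynomial_upper {n c d : ℕ} (hc : c < n) (hd : d < n) (p : NodeIndex n) :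
    ∃ P : MvPolynomial (Fin 2) ℝ, P.totalDegree ≤ 3 ∧
      ∀ x ∈ upperTriangle n c d, cubicBasisFun n p x = MvPolynomial.eval ![x.1, x.2] P := by
  have hn : n ≠ 0 := by omega
  refine exists_polynomial p _ {(c + 1, d + 1), (c, d + 1), (c + 1, d)} ?_ ?_ ?_ ?_
  · intro V hV
    simp only [Finset.mem_insert, Finset.mem_singleton] at hV
    rcases hV with rfl | rfl | rfl <;> simp <;> omega
  · intro V hV
    simp only [Finset.mem_insert, Finset.mem_singleton] at hV
    rcases hV with rfl | rfl | rfl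
    · refine ⟨n, n, -1 - c - d, fun x hx => ?_⟩
      obtain ⟨h1, h2, h3⟩ := mem_upperTriangle hn hx
      refine hat_eq ?_ (abs_le.2 ⟨?_, ?_⟩) (abs_le.2 ⟨?_, ?_⟩) (abs_le.2 ⟨?_, ?_⟩)
        (Or.inr (Or.inr (le_abs.2 ?_))) <;> push_cast
      any_goals linarith
      right
      linarith
    · refine ⟨-n, 0, 1 + c, fun x hx => ?_⟩
      obtain ⟨h1, h2, h3⟩ := mem_upperTriangle hn hx
      refine hat_eq ?_ (abs_le.2 ⟨?_, ?_⟩) (abs_le.2 ⟨?_, ?_⟩) (abs_le.2 ⟨?_, ?_⟩)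
        (Or.inl (le_abs.2 ?_)) <;> push_cast
      any_goals linarith
      left
      linarith
    · refine ⟨0, -n, 1 + d, fun x hx => ?_⟩
      obtain ⟨h1, h2, h3⟩ := mem_upperTriangle hn hx
      refine hat_eq ?_ (abs_le.2 ⟨?_, ?_⟩) (abs_le.2 ⟨?_, ?_⟩) (abs_le.2 ⟨?_, ?_⟩)
        (Or.inr (Or.inl (le_abs.2 ?_))) <;> push_cast
      any_goals linarith
      left
      linarith
  · rintro ⟨i, j⟩ hV x hx
    simp only [Finset.mem_insert, Finset.mem_singleton, Prod.mk.injEq] at hV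
    obtain ⟨h1, h2, h3⟩ := mem_upperTriangle hn hx
    apply hat_eq_zero
    simp only [le_abs]
    have hcase : i + 1 ≤ c ∨ c + 2 ≤ i ∨ j + 1 ≤ d ∨ d + 2 ≤ j ∨ i + j ≤ c + d := by omega
    rcases hcase with h | h | h | h | h
    · have : (i : ℝ) + 1 ≤ c := by exact_mod_cast h
      left; left; linarith
    · have : (c : ℝ) + 2 ≤ i := by exact_mod_cast h
      left; right; linarith
    · have : (j : ℝ) + 1 ≤ d := by exact_mod_cast h
      right; left; left; linarith
    · have : (d : ℝ) + 2 ≤ j := by exact_mod_cast h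
      right; left; right; linarith
    · have : (i : ℝ) + j ≤ c + d := by exact_mod_cast h
      right; right; left; linarith
  · rw [Finset.sum_insert (by simp), Finset.sum_insert (by simp), Finset.sum_singleton]
    have h0 := le_nodeWeight (le_refl (nodeWeight ((p.1 : ℕ) + 1) ((p.2 : ℕ) + 1) (c + 1, d + 1)))
    have h1 := le_nodeWeight (le_refl (nodeWeight ((p.1 : ℕ) + 1) ((p.2 : ℕ) + 1) (c, d + 1)))
    have h2 := le_nodeWeight (le_refl (nodeWeight ((p.1 : ℕ) + 1) ((p.2 : ℕ) + 1) (c + 1, d)))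
    generalize nodeWeight ((p.1 : ℕ) + 1) ((p.2 : ℕ) + 1) (c + 1, d + 1) = w0 at *
    generalize nodeWeight ((p.1 : ℕ) + 1) ((p.2 : ℕ) + 1) (c, d + 1) = w1 at *
    generalize nodeWeight ((p.1 : ℕ) + 1) ((p.2 : ℕ) + 1) (c + 1, d) = w2 at *
    simp only at h0 h1 h2
    omega

theorem cubicBasisFun_mem (n : ℕ) (p : NodeIndex n) : cubicBasisFun n p ∈ lagrangeSpace 3 n := by
  refine ⟨continuous_cubicBasisFun n p, fun x hx => cubicBasisFun_boundary p hx, ?_⟩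
  rintro K ⟨c, d, hc, hd, rfl | rfl⟩
  · exact exists_polynomial_lower hc hd p
  · exact exists_polynomial_upper hc hd p

/-- The cubic nodal basis: the function of index `p` belongs to the finite element space, has value
`1` at the node `p` and value `0` at all other nodes (see `cubicBasis_node`). -/
noncomputable def cubicBasis (n : ℕ) (p : NodeIndex n) : lagrangeSpace 3 n :=
  ⟨cubicBasisFun n p, cubicBasisFun_mem n p⟩

theorem cubicBasis_node {n : ℕ} (p q : NodeIndex n) :
    (cubicBasis n p : ℝ × ℝ → ℝ) (node n q) = if q = p then 1 else 0 :=
  cubicBasisFun_node p q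

/-- The scalar product of the gradients of two functions on the plane. -/
noncomputable def gradDot (φ ψ : ℝ × ℝ → ℝ) (x : ℝ × ℝ) : ℝ :=
  fderiv ℝ φ x (1, 0) * fderiv ℝ ψ x (1, 0) + fderiv ℝ φ x (0, 1) * fderiv ℝ ψ x (0, 1)

/-- The stiffness matrix of the cubic elements for the diffusion coefficient `a` on the unit square:
its entries are the integrals of `a ∇φ_q · ∇φ_p`. The basis functions are differentiable off the
edges of the mesh, hence almost everywhere. -/
noncomputable def stiffness (a : ℝ × ℝ → ℝ) (n : ℕ) : Matrix (NodeIndex n) (NodeIndex n) ℝ :=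
  Matrix.of fun p q => ∫ x in unitSquare, a x * gradDot (cubicBasis n q) (cubicBasis n p) x

/-! ### The symbol -/

/-- The `9 × 9` matrix-valued symbol of the cubic elements. -/
noncomputable def symbolP3 (θ : ℝ × ℝ) : Matrix (Fin 9) (Fin 9) ℂ :=
  let α : ℂ := 81 / 10
  let β : ℂ := 27 / 4
  let γ : ℂ := 3 / 40
  let δ : ℂ := 57 / 80
  let ε : ℂ := 21 / 16
  let ζ : ℂ := 17 / 5
  let η : ℂ := 7 / 40
  let e₁ : ℂ := Complex.exp (Complex.I * (θ.1 : ℂ))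
  let e₂ : ℂ := Complex.exp (Complex.I * (θ.2 : ℂ))
  let e₁' : ℂ := Complex.exp (-(Complex.I * (θ.1 : ℂ)))
  let e₂' : ℂ := Complex.exp (-(Complex.I * (θ.2 : ℂ)))
  let f₂₉ : ℂ := -γ * (1 - e₁) * (1 - e₂)
  let f₃₉ : ℂ := δ - γ / 2 * e₁ - ε * e₂ - γ / 2 * e₁' * e₂
  let f₄₉ : ℂ := -γ * (1 - e₁) * (1 - e₂)
  let f₆₉ : ℂ := -ε - γ / 2 * e₁ + δ * e₂ - γ / 2 * e₁' * e₂
  let f₇₉ : ℂ := δ - ε * e₁ - γ / 2 * e₁ * e₂' - γ / 2 * e₂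
  let f₈₉ : ℂ := -ε + δ * e₁ - γ / 2 * e₁ * e₂' - γ / 2 * e₂
  let f₉₉ : ℂ := ζ - 2 * η * (Complex.cos (θ.1 : ℂ) + Complex.cos (θ.2 : ℂ))
  !![α, -α / 4, -α / 4 * e₁, -α / 4, 0, 0, -α / 4 * e₂, 0, 0;
    -α / 4, β, -β / 4 + β / 20 * e₁, -β / 5, -α / 4, β / 20 * (1 + e₁), β / 20 * (1 + e₂),
      β / 20 - β / 4 * e₂, f₂₉;
    -α / 4 * e₁', -β / 4 + β / 20 * e₁', β, β / 20 * (1 + e₁'), 0, -β / 2, 0, 0, f₃₉;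
    -α / 4, -β / 5, β / 20 * (1 + e₁), β, -α / 4, β / 20 - β / 4 * e₁, -β / 4 + β / 20 * e₂,
      β / 20 * (1 + e₂), f₄₉;
    0, -α / 4, 0, -α / 4, α, -α / 4, 0, -α / 4, 0;
    0, β / 20 * (1 + e₁'), -β / 2, β / 20 - β / 4 * e₁', -α / 4, β, 0, 0, f₆₉;
    -α / 4 * e₂', β / 20 * (1 + e₂'), 0, -β / 4 + β / 20 * e₂', 0, 0, β, -β / 2, f₇₉;
    0, β / 20 - β / 4 * e₂', 0, β / 20 * (1 + e₂'), -α / 4, 0, -β / 2, β, f₈₉;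
    0, starRingEnd ℂ f₂₉, starRingEnd ℂ f₃₉, starRingEnd ℂ f₄₉, 0, starRingEnd ℂ f₆₉,
      starRingEnd ℂ f₇₉, starRingEnd ℂ f₈₉, f₉₉]

end FEM

namespace FEM

/-! ### Spectral distributions from moments -/

section Hermitian

variable {m : Type*} [Fintype m] [DecidableEq m] {A : Matrix m m ℂ}

/-! Give every internal node the label (cell, type): the cell of the `n × n` grid that contains it,
right and upper edges included, and its position there, one of nine. The mesh is invariant under
translations by cells, so away from the boundary a stiffness entry depends only on the difference of
the cells and on the two types. This persists up to the boundary, because every triangle that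
contains an internal node belongs to the mesh. So the stiffness matrix is exactly a principal
submatrix of a block Laurent operator. Its coefficients are the Fourier coefficients of the symbol,
and `T_n` is the submatrix of the same operator on the full box of cells. The only labels missing
from the stiffness matrix are those of the nodes on the right and upper sides of the square, which
are `6n - 1` of `9n²`.

Both distributions therefore follow from one statement, `spectrallyDistributed_section`. The
coefficients vanish beyond nearest neighbours. A diagonal entry of the `k`-th power thus involves
only cells within distance `k`, and if all of these are present it equals the corresponding entry of
the zeroth Fourier coefficient of the `k`-th power of the symbol (`pow_section_apply`). All but
`O(n)` indices are that deep, so the normalised traces of powers converge to the moments of the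
symbol (`tendsto_trace_pow_section`). The matrices are Hermitian with uniformly bounded row sums,
hence all eigenvalues lie in one compact interval. There the Weierstrass theorem passes from
polynomials to continuous functions (`spectrallyDistributed_of_moments`).

It remains to identify the coefficients. On each triangle a basis function is a cubic shape function
of a reference triangle (`cubicBasisFun_eq_shape`). In two dimensions scaling does not change the
Dirichlet integral, so assembly only adds entries of one `10 × 10` matrix of rational numbers
(`stiffness_apply`, `refStiffness_eq`). With denominators cleared, the comparison with the symbol is
a finite check over the integers (`symbolTable_eq_sum_cellEntry`, `symbolP3_eq`). -/

theorem eigSum_eq_sum_eigenvalues (hA : A.IsHermitian) (F : ℂ → ℂ) :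
    eigSum A F = ∑ i, F (hA.eigenvalues i) := by
  unfold eigSum
  rw [hA.roots_charpoly_eq_eigenvalues, Multiset.map_map]
  rfl

theorem trace_pow_eq_sum_eigenvalues (hA : A.IsHermitian) (k : ℕ) :
    (A ^ k).trace = ∑ i, (hA.eigenvalues i : ℂ) ^ k := by
  conv_lhs => rw [hA.spectral_theorem, ← map_pow, Unitary.conjStarAlgAut_apply,
    Matrix.trace_mul_cycle]
  simp [Matrix.diagonal_pow, Matrix.trace_diagonal]

/-- Eigenvalue statistics become traces of powers, which can be computed from the matrix entries. -/
theorem eigSum_polynomial (hA : A.IsHermitian) (P : Polynomial ℂ) :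
    eigSum A (fun z => P.eval z) = P.sum fun k a => a * (A ^ k).trace := by
  rw [eigSum_eq_sum_eigenvalues hA]
  simp only [Polynomial.eval_eq_sum, Polynomial.sum_def, trace_pow_eq_sum_eigenvalues hA,
    Finset.mul_sum]
  exact Finset.sum_comm

/-- Read the eigenvalue equation at a coordinate where the eigenvector is largest. Row sums are the
convenient bound here, because those of a section are controlled by the coefficients, independently
of its size. -/
theorem abs_eigenvalues_le (hA : A.IsHermitian) {C : ℝ} (hC : ∀ i, ∑ j, ‖A i j‖ ≤ C) (i : m) :
    |hA.eigenvalues i| ≤ C := by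
  set v : m → ℂ := ⇑(hA.eigenvectorBasis i) with hv
  have hne : v ≠ 0 := by
    intro h
    have h1 := hA.eigenvectorBasis.orthonormal.1 i
    have : hA.eigenvectorBasis i = 0 := by
      ext j
      exact congrFun h j
    rw [this] at h1
    simp at h1
  have hmul : A.mulVec v = (hA.eigenvalues i) • v := hA.mulVec_eigenvectorBasis i
  obtain ⟨j, -, hj⟩ := Finset.exists_max_image Finset.univ (fun j => ‖v j‖) ⟨i, Finset.mem_univ i⟩
  have hpos : 0 < ‖v j‖ := by
    obtain ⟨l, hl⟩ := Function.ne_iff.1 hne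
    exact lt_of_lt_of_le (norm_pos_iff.2 hl) (hj l (Finset.mem_univ l))
  refine le_of_mul_le_mul_right ?_ hpos
  calc |hA.eigenvalues i| * ‖v j‖ = ‖A.mulVec v j‖ := by rw [hmul]; simp
    _ ≤ ∑ l, ‖A j l‖ * ‖v j‖ := by
        refine (norm_sum_le _ _).trans (Finset.sum_le_sum fun l _ => ?_)
        rw [norm_mul]
        exact mul_le_mul_of_nonneg_left (hj l (Finset.mem_univ l)) (norm_nonneg _)
    _ ≤ C * ‖v j‖ := by
        rw [← Finset.sum_mul]
        exact mul_le_mul_of_nonneg_right (hC j) (norm_nonneg _)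

/-- The maximal row sum is a submultiplicative norm. This bounds the diagonal entries of powers at
indices near the boundary, where no formula is available. -/
theorem sum_norm_pow_le {C : ℝ} (h0 : 0 ≤ C) (hC : ∀ i, ∑ j, ‖A i j‖ ≤ C) (k : ℕ) (i : m) :
    ∑ j, ‖(A ^ k) i j‖ ≤ C ^ k := by
  induction k generalizing i with
  | zero => simp [Matrix.one_apply, apply_ite norm]
  | succ k ih =>
    calc ∑ j, ‖(A ^ (k + 1)) i j‖ ≤ ∑ j, ∑ l, ‖A i l‖ * ‖(A ^ k) l j‖ := by
          refine Finset.sum_le_sum fun j _ => ?_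
          rw [pow_succ', Matrix.mul_apply]
          exact (norm_sum_le _ _).trans (by simp)
      _ = ∑ l, ‖A i l‖ * ∑ j, ‖(A ^ k) l j‖ := by
          rw [Finset.sum_comm]; simp only [Finset.mul_sum]
      _ ≤ ∑ l, ‖A i l‖ * C ^ k :=
          Finset.sum_le_sum fun l _ => mul_le_mul_of_nonneg_left (ih l) (norm_nonneg _)
      _ ≤ C ^ (k + 1) := by
          rw [← Finset.sum_mul, pow_succ']
          exact mul_le_mul_of_nonneg_right (hC i) (pow_nonneg h0 k)

theorem norm_eigSum_sub_le (hA : A.IsHermitian) {C δ : ℝ} (hC : ∀ i, ∑ j, ‖A i j‖ ≤ C)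
    {F G : ℂ → ℂ} (hFG : ∀ t : ℝ, |t| ≤ C → ‖F t - G t‖ ≤ δ) :
    ‖eigSum A F - eigSum A G‖ ≤ Fintype.card m * δ := by
  rw [eigSum_eq_sum_eigenvalues hA, eigSum_eq_sum_eigenvalues hA, ← Finset.sum_sub_distrib]
  refine (norm_sum_le _ _).trans ?_
  refine (Finset.sum_le_card_nsmul _ _ δ fun i _ => hFG _ (abs_eigenvalues_le hA hC i)).trans ?_
  simp

theorem norm_mean_eigSum_sub_le (hA : A.IsHermitian) {C δ : ℝ} (hδ : 0 ≤ δ)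
    (hC : ∀ i, ∑ j, ‖A i j‖ ≤ C)
    {F G : ℂ → ℂ} (hFG : ∀ t : ℝ, |t| ≤ C → ‖F t - G t‖ ≤ δ) :
    ‖(Fintype.card m : ℂ)⁻¹ * eigSum A F - (Fintype.card m : ℂ)⁻¹ * eigSum A G‖ ≤ δ := by
  rw [← mul_sub, norm_mul, norm_inv, Complex.norm_natCast]
  calc _ ≤ (Fintype.card m : ℝ)⁻¹ * (Fintype.card m * δ) :=
        mul_le_mul_of_nonneg_left (norm_eigSum_sub_le hA hC hFG) (by positivity)
    _ ≤ δ := by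
        rw [← mul_assoc]
        -- An inequality suffices and also covers an empty index type, where the factor is `0`
        -- instead of `1`.
        exact mul_le_of_le_one_left hδ (inv_mul_le_one)

end Hermitian

/-- Weierstrass approximation of the real and imaginary parts, each up to `δ / 2`. Approximation on
a real interval is enough because Hermitian matrices have real eigenvalues. -/
theorem exists_polynomial_near {F : ℂ → ℂ} (hF : Continuous F) (C : ℝ) {δ : ℝ} (hδ : 0 < δ) :
    ∃ P : Polynomial ℂ, ∀ t : ℝ, |t| ≤ C → ‖F t - P.eval (t : ℂ)‖ ≤ δ := by
  obtain ⟨p, hp⟩ := exists_polynomial_near_of_continuousOn (-C) C (fun t => (F t).re)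
    (Continuous.continuousOn (by fun_prop)) (δ / 2) (by positivity)
  obtain ⟨q, hq⟩ := exists_polynomial_near_of_continuousOn (-C) C (fun t => (F t).im)
    (Continuous.continuousOn (by fun_prop)) (δ / 2) (by positivity)
  refine ⟨p.map Complex.ofRealHom + Polynomial.C Complex.I * q.map Complex.ofRealHom,
    fun t ht => ?_⟩
  have ep : ∀ p : Polynomial ℝ, (p.map Complex.ofRealHom).eval (t : ℂ) = ((p.eval t : ℝ) : ℂ) :=
    fun p => by
      have := Polynomial.eval_map_apply (p := p) (f := Complex.ofRealHom) t
      simpa using this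
  rw [Polynomial.eval_add, Polynomial.eval_mul, Polynomial.eval_C, ep, ep]
  have hp' := hp t (abs_le.1 ht)
  have hq' := hq t (abs_le.1 ht)
  refine (Complex.norm_le_abs_re_add_abs_im _).trans ?_
  simp only [Complex.sub_re, Complex.add_re, Complex.ofReal_re, Complex.mul_re, Complex.I_re,
    Complex.I_im, Complex.ofReal_im, Complex.sub_im, Complex.add_im, Complex.mul_im]
  rw [abs_sub_comm] at hp' hq'
  ring_nf at hp' hq' ⊢
  linarith

section Distribution

variable {r : ℕ} {f : ℝ × ℝ → Matrix (Fin r) (Fin r) ℂ}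

theorem continuous_pow_apply (hf : ∀ i j, Continuous fun x => f x i j) (k : ℕ) (i j : Fin r) :
    Continuous fun x => (f x ^ k) i j := by
  have : Continuous f := continuous_matrix hf
  exact (this.pow k).matrix_elem i j

theorem continuous_eigSum_polynomial (hf : ∀ i j, Continuous fun x => f x i j)
    (hH : ∀ x, (f x).IsHermitian) (P : Polynomial ℂ) :
    Continuous fun x => eigSum (f x) (fun z => P.eval z) := by
  simp only [eigSum_polynomial (hH _), Polynomial.sum_def, Matrix.trace, Matrix.diag_apply]
  have := continuous_pow_apply hf
  exact continuous_finsetSum _ fun k _ => continuous_const.mul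
    (continuous_finsetSum _ fun i _ => this k i i)

/-- No continuity of individual eigenvalues is needed: the function is a uniform limit of the
eigenvalue sums of polynomials, which are continuous because they are traces of powers. -/
theorem continuous_eigSum (hf : ∀ i j, Continuous fun x => f x i j)
    (hH : ∀ x, (f x).IsHermitian) {C : ℝ} (hC : ∀ x i, ∑ j, ‖f x i j‖ ≤ C)
    {F : ℂ → ℂ} (hF : Continuous F) : Continuous fun x => eigSum (f x) F := by
  have key : ∀ k : ℕ, ∃ P : Polynomial ℂ, ∀ t : ℝ, |t| ≤ C →
      ‖F t - P.eval (t : ℂ)‖ ≤ 1 / ((k : ℝ) + 1) :=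
    fun k => exists_polynomial_near hF C (by positivity)
  choose P hP using key
  have hlim : TendstoUniformly (fun k x => eigSum (f x) (fun z => (P k).eval z))
      (fun x => eigSum (f x) F) atTop := by
    rw [Metric.tendstoUniformly_iff]
    intro ε hε
    have h0 : Tendsto (fun k : ℕ => (r : ℝ) * (1 / ((k : ℝ) + 1))) atTop (𝓝 0) := by
      simpa using tendsto_one_div_add_atTop_nhds_zero_nat.const_mul (r : ℝ)
    filter_upwards [h0.eventually (gt_mem_nhds hε)] with k hk x
    rw [dist_eq_norm]
    refine lt_of_le_of_lt (norm_eigSum_sub_le (hH x) (hC x) (hP k)) ?_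
    simpa using hk
  exact hlim.continuous (Frequently.of_forall fun k => continuous_eigSum_polynomial hf hH (P k))

/-- Convergence of the moments of uniformly bounded Hermitian matrices to those of a continuous
Hermitian symbol gives the spectral distribution. -/
theorem spectrallyDistributed_of_moments {m : ℕ → Type*} [∀ n, Fintype (m n)]
    [∀ n, DecidableEq (m n)] {A : ∀ n, Matrix (m n) (m n) ℂ} {D : Set (ℝ × ℝ)}
    (hD : IsCompact D) (hD0 : 0 < volume D)
    (hf : ∀ i j, Continuous fun x => f x i j) (hH : ∀ x, (f x).IsHermitian)
    (hA : ∀ n, (A n).IsHermitian) {C : ℝ} (hCf : ∀ x i, ∑ j, ‖f x i j‖ ≤ C)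
    (hCA : ∀ n i, ∑ j, ‖A n i j‖ ≤ C)
    (hmom : ∀ k : ℕ, Tendsto (fun n => (Fintype.card (m n) : ℂ)⁻¹ * (A n ^ k).trace) atTop
      (𝓝 (((volume D).toReal : ℂ)⁻¹ * ∫ x in D, (f x ^ k).trace / (r : ℂ)))) :
    SpectrallyDistributed A D f where
  measurableSet := hD.measurableSet
  measure_pos := hD0
  measure_lt_top := hD.measure_lt_top
  aemeasurable i j := (hf i j).aemeasurable
  tendsto := by
    intro F hF _
    have hpos : 0 < (volume D).toReal := ENNReal.toReal_pos hD0.ne' hD.measure_lt_top.ne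
    have hint : ∀ g : ℝ × ℝ → ℂ, Continuous g → IntegrableOn g D :=
      fun g hg => hg.continuousOn.integrableOn_compact hD
    have hpoly : ∀ P : Polynomial ℂ, Tendsto (fun n => (Fintype.card (m n) : ℂ)⁻¹ *
        eigSum (A n) (fun z => P.eval z)) atTop
        (𝓝 (((volume D).toReal : ℂ)⁻¹ * ∫ x in D, eigSum (f x) (fun z => P.eval z) / (r : ℂ))) := by
      intro P
      simp only [eigSum_polynomial (hA _), eigSum_polynomial (hH _), Polynomial.sum_def,
        Finset.sum_div]
      rw [integral_finsetSum]
      · simp only [Finset.mul_sum]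
        refine tendsto_finsetSum _ fun k _ => ?_
        have := (hmom k).const_mul (P.coeff k)
        simp only [mul_div_assoc, integral_const_mul]
        refine (this.congr fun n => ?_).trans (le_of_eq ?_)
        · ring
        · congr 1; ring
      · intro k _
        refine hint _ ?_
        have := continuous_pow_apply hf
        exact (continuous_const.mul (continuous_finsetSum _ fun i _ => this k i i)).div_const _
    rw [Metric.tendsto_atTop]
    intro ε hε
    -- Three errors of size `ε / 4`: replacing `F` by `P` for the matrices, the limit for `P`, and
    -- replacing `P` by `F` for the symbol.
    obtain ⟨P, hP⟩ := exists_polynomial_near hF C (δ := ε / 4) (by positivity)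
    obtain ⟨N, hN⟩ := Metric.tendsto_atTop.1 (hpoly P) (ε / 4) (by positivity)
    refine ⟨N, fun n hn => ?_⟩
    have h1 := norm_mean_eigSum_sub_le (hA n) (F := F) (G := fun z => P.eval z)
      (δ := ε / 4) (by positivity) (hCA n) hP
    have h2 := hN n hn
    have h3 : ‖((volume D).toReal : ℂ)⁻¹ * (∫ x in D, eigSum (f x) F / (r : ℂ)) -
        ((volume D).toReal : ℂ)⁻¹ * ∫ x in D, eigSum (f x) (fun z => P.eval z) / (r : ℂ)‖
        ≤ ε / 4 := by
      rw [← mul_sub, ← integral_sub (hint _ ((continuous_eigSum hf hH hCf hF).div_const _))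
        (hint _ ((continuous_eigSum_polynomial hf hH P).div_const _)), norm_mul, norm_inv,
        Complex.norm_real, Real.norm_of_nonneg hpos.le]
      have h4 : ‖∫ x in D, (eigSum (f x) F / (r : ℂ) - eigSum (f x) (fun z => P.eval z) / (r : ℂ))‖
          ≤ ε / 4 * (volume D).toReal := by
        refine norm_setIntegral_le_of_norm_le_const hD.measure_lt_top fun x _ => ?_
        have := norm_mean_eigSum_sub_le (hH x) (F := F) (G := fun z => P.eval z)
          (δ := ε / 4) (by positivity) (hCf x) hP
        simpa [div_eq_inv_mul] using this
      calc _ ≤ (volume D).toReal⁻¹ * (ε / 4 * (volume D).toReal) :=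
            mul_le_mul_of_nonneg_left h4 (by positivity)
        _ = ε / 4 := by field_simp
    rw [dist_eq_norm] at h2 ⊢
    generalize (Fintype.card (m n) : ℂ)⁻¹ * eigSum (A n) F = a at *
    generalize (Fintype.card (m n) : ℂ)⁻¹ * eigSum (A n) (fun z => P.eval z) = b at *
    generalize ((volume D).toReal : ℂ)⁻¹ * (∫ x in D, eigSum (f x) F / (r : ℂ)) = c at *
    generalize ((volume D).toReal : ℂ)⁻¹ *
      (∫ x in D, eigSum (f x) (fun z => P.eval z) / (r : ℂ)) = d at *
    have e : a - c = (a - b) + (b - d) - (c - d) := by ring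
    rw [e]
    have := norm_sub_le ((a - b) + (b - d)) (c - d)
    have := norm_add_le (a - b) (b - d)
    linarith

end Distribution

/-! ### Fourier coefficients of trigonometric polynomials -/

/-- The character `θ ↦ exp (i (j₁ θ₁ + j₂ θ₂))`. -/
noncomputable def character (j : ℤ × ℤ) (θ : ℝ × ℝ) : ℂ :=
  Complex.exp (Complex.I * ((j.1 : ℂ) * (θ.1 : ℂ) + (j.2 : ℂ) * (θ.2 : ℂ)))

theorem continuous_character (j : ℤ × ℤ) : Continuous (character j) := by
  unfold character; fun_prop

theorem isCompact_fourierSquare : IsCompact fourierSquare := isCompact_Icc.prod isCompact_Icc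

theorem volume_fourierSquare : volume fourierSquare = ENNReal.ofReal ((2 * Real.pi) ^ 2) := by
  unfold fourierSquare
  rw [Measure.volume_eq_prod, Measure.prod_prod, Real.volume_Icc,
    ← ENNReal.ofReal_mul (by linarith [Real.pi_pos])]
  congr 1; ring

/-- The indices of the nearest neighbours of the origin. -/
def neighbours : Finset (ℤ × ℤ) := {-1, 0, 1} ×ˢ {-1, 0, 1}

/-- The trigonometric polynomial with the given coefficients. -/
noncomputable def trigPoly {r : ℕ} (c : ℤ × ℤ → Matrix (Fin r) (Fin r) ℂ) (θ : ℝ × ℝ) :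
    Matrix (Fin r) (Fin r) ℂ :=
  ∑ j ∈ neighbours, character j θ • c j

section

variable {r : ℕ} {c : ℤ × ℤ → Matrix (Fin r) (Fin r) ℂ}

theorem continuous_trigPoly : Continuous (trigPoly c) := by
  unfold trigPoly
  exact continuous_finsetSum _ fun j _ => (continuous_character j).smul continuous_const

/-- Multiplication by the symbol acts on Fourier coefficients as convolution. This is the recursion
that powers of a section obey in the interior. -/
theorem fourierCoeff₂_trigPoly_mul {g : ℝ × ℝ → Matrix (Fin r) (Fin r) ℂ} (hg : Continuous g)
    (k : ℤ × ℤ) : fourierCoeff₂ (fun θ => trigPoly c θ * g θ) k.1 k.2 =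
      ∑ j ∈ neighbours, c j * fourierCoeff₂ g (k - j).1 (k - j).2 := by
  ext a b
  simp only [Matrix.sum_apply, Matrix.mul_apply, fourierCoeff₂, Matrix.of_apply]
  have e : ∀ θ : ℝ × ℝ, (∑ l, trigPoly c θ a l * g θ l b) *
      Complex.exp (-Complex.I * ((k.1 : ℂ) * (θ.1 : ℂ) + (k.2 : ℂ) * (θ.2 : ℂ))) =
      ∑ j ∈ neighbours, ∑ l, c j a l * (g θ l b *
        Complex.exp (-Complex.I * (((k - j).1 : ℂ) * (θ.1 : ℂ) + ((k - j).2 : ℂ) * (θ.2 : ℂ)))) := by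
    intro θ
    rw [Finset.sum_comm, Finset.sum_mul]
    refine Finset.sum_congr rfl fun l _ => ?_
    simp only [trigPoly, Matrix.sum_apply, Matrix.smul_apply, Finset.sum_mul, smul_eq_mul,
      character]
    refine Finset.sum_congr rfl fun j _ => ?_
    have : Complex.exp (-Complex.I * (((k - j).1 : ℂ) * (θ.1 : ℂ) + ((k - j).2 : ℂ) * (θ.2 : ℂ))) =
        Complex.exp (Complex.I * ((j.1 : ℂ) * (θ.1 : ℂ) + (j.2 : ℂ) * (θ.2 : ℂ))) *
        Complex.exp (-Complex.I * ((k.1 : ℂ) * (θ.1 : ℂ) + (k.2 : ℂ) * (θ.2 : ℂ))) := by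
      rw [← Complex.exp_add]
      congr 1
      simp only [Prod.fst_sub, Prod.snd_sub]
      push_cast
      ring
    rw [this]
    ring
  simp only [e]
  have hint : ∀ (j : ℤ × ℤ) (l : Fin r), Integrable (fun θ : ℝ × ℝ => c j a l * (g θ l b *
      Complex.exp (-Complex.I * (((k - j).1 : ℂ) * (θ.1 : ℂ) + ((k - j).2 : ℂ) * (θ.2 : ℂ)))))
      (volume.restrict fourierSquare) := by
    intro j l
    have := hg.matrix_elem l b
    exact ContinuousOn.integrableOn_compact isCompact_fourierSquare
      (Continuous.continuousOn (by fun_prop))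
  rw [integral_finsetSum _ fun j _ => integrable_finsetSum _ fun l _ => hint j l, Finset.mul_sum]
  refine Finset.sum_congr rfl fun j _ => ?_
  rw [integral_finsetSum _ fun l _ => hint j l, Finset.mul_sum]
  refine Finset.sum_congr rfl fun l _ => ?_
  rw [integral_const_mul]
  ring

theorem integral_exp_int (k : ℤ) :
    ∫ t in Set.Icc (-Real.pi) Real.pi, Complex.exp (-Complex.I * ((k : ℂ) * (t : ℂ))) =
      if k = 0 then 2 * (Real.pi : ℂ) else 0 := by
  rw [integral_Icc_eq_integral_Ioc,
    ← intervalIntegral.integral_of_le (by linarith [Real.pi_pos])]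
  split_ifs with h
  · subst h
    simp
    ring
  · have h' : (-Complex.I * (k : ℂ)) ≠ 0 := by simp [h]
    simp only [← mul_assoc]
    rw [integral_exp_mul_complex h']
    -- The primitive takes the same value at both ends, since the exponents differ by `-k` periods
    -- `2πi`.
    have : Complex.exp (-Complex.I * (k : ℂ) * (Real.pi : ℂ)) =
        Complex.exp (-Complex.I * (k : ℂ) * ((-Real.pi : ℝ) : ℂ)) := by
      rw [Complex.exp_eq_exp_iff_exists_int]
      exact ⟨-k, by push_cast; ring⟩
    rw [this, sub_self, zero_div]

theorem fourierCoeff₂_one (k : ℤ × ℤ) :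
    fourierCoeff₂ (fun _ => (1 : Matrix (Fin r) (Fin r) ℂ)) k.1 k.2 = if k = 0 then 1 else 0 := by
  ext a b
  simp only [fourierCoeff₂, Matrix.of_apply]
  rw [integral_const_mul]
  have e : ∀ θ : ℝ × ℝ,
      Complex.exp (-Complex.I * ((k.1 : ℂ) * (θ.1 : ℂ) + (k.2 : ℂ) * (θ.2 : ℂ))) =
      Complex.exp (-Complex.I * ((k.1 : ℂ) * (θ.1 : ℂ))) *
      Complex.exp (-Complex.I * ((k.2 : ℂ) * (θ.2 : ℂ))) := by
    intro θ
    rw [← Complex.exp_add, mul_add]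
  simp only [e]
  unfold fourierSquare
  rw [Measure.volume_eq_prod, setIntegral_prod_mul
    (fun t : ℝ => Complex.exp (-Complex.I * ((k.1 : ℂ) * (t : ℂ))))
    (fun t : ℝ => Complex.exp (-Complex.I * ((k.2 : ℂ) * (t : ℂ)))),
    integral_exp_int, integral_exp_int]
  have hpi : (Real.pi : ℂ) ≠ 0 := by exact_mod_cast Real.pi_ne_zero
  by_cases h1 : k.1 = 0 <;> by_cases h2 : k.2 = 0 <;> simp [h1, h2, Prod.ext_iff]
  field_simp

/-- The convolution formula with the constant function `1`, whose only nonzero coefficient sits at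
frequency `0`. -/
theorem fourierCoeff₂_trigPoly (hc : ∀ j ∉ neighbours, c j = 0) (k : ℤ × ℤ) :
    fourierCoeff₂ (trigPoly c) k.1 k.2 = c k := by
  have := fourierCoeff₂_trigPoly_mul (c := c) (g := fun _ => 1) continuous_const k
  simp only [mul_one, fourierCoeff₂_one] at this
  rw [this]
  simp only [sub_eq_zero, mul_ite, mul_one, mul_zero]
  rw [Finset.sum_ite_eq]
  split_ifs with h
  · rfl
  · exact (hc k h).symm

theorem mem_neighbours {j : ℤ × ℤ} : j ∈ neighbours ↔ |j.1| ≤ 1 ∧ |j.2| ≤ 1 := by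
  simp only [neighbours, Finset.mem_product, Finset.mem_insert, Finset.mem_singleton, abs_le]
  omega

/-! ### Sections of block Laurent operators -/

variable {m : Type*} [Fintype m] {B : Matrix m m ℂ} {ι : m → (ℤ × ℤ) × Fin r}

/-- A matrix product in a section sums over the index type, a convolution over all pairs of a cell
and a type. The two sums agree once the summand vanishes outside the image of `j` and outside `S`.
-/
theorem sum_comp_eq_sum_product {α β : Type*} [Fintype β] {j : m → α × β}
    (hj : Function.Injective j) {H : α × β → ℂ} {S : Finset α} (hS : ∀ w, H w ≠ 0 → w.1 ∈ S)
    (hr : ∀ w, H w ≠ 0 → w ∈ Set.range j) :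
    ∑ z, H (j z) = ∑ w ∈ S ×ˢ Finset.univ, H w := by
  rw [← tsum_fintype (L := .unconditional _) fun z => H (j z), hj.tsum_eq fun w hw => hr w hw,
    tsum_eq_sum fun w hw => ?_]
  by_contra h
  exact hw (Finset.mem_product.2 ⟨hS w h, Finset.mem_univ _⟩)

/-- A path of `k` nearest-neighbour steps from `x` stays within distance `k`, so it does not see the
truncation if all those blocks are present. In the induction the first step, from `x` to `z`, uses
up one unit of depth; this is why `x` is generalised. -/
theorem pow_section_apply [DecidableEq m] (hc : ∀ j ∉ neighbours, c j = 0) (hι : Function.Injective ι)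
    (hB : ∀ x y, B x y = c ((ι x).1 - (ι y).1) (ι x).2 (ι y).2) (k : ℕ) (x y : m)
    (hx : ∀ w : ℤ × ℤ, |w.1 - (ι x).1.1| ≤ k → |w.2 - (ι x).1.2| ≤ k →
      ∀ s, (w, s) ∈ Set.range ι) :
    (B ^ k) x y = fourierCoeff₂ (fun θ => trigPoly c θ ^ k) ((ι x).1 - (ι y).1).1
      ((ι x).1 - (ι y).1).2 (ι x).2 (ι y).2 := by
  induction k generalizing x with
  | zero =>
    simp only [pow_zero, fourierCoeff₂_one, sub_eq_zero]
    by_cases h : x = y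
    · subst h; simp
    · rw [Matrix.one_apply_ne h]
      split_ifs with h1
      · rw [Matrix.one_apply_ne]
        exact fun h2 => h (hι (Prod.ext h1 h2))
      · rfl
  | succ k ih =>
    have e : (fun θ => trigPoly c θ ^ (k + 1)) =
        fun θ => trigPoly c θ * (fun θ => trigPoly c θ ^ k) θ := by
      ext1 θ; exact pow_succ' _ _
    rw [e, fourierCoeff₂_trigPoly_mul (g := fun θ => trigPoly c θ ^ k) (continuous_trigPoly.pow k),
      pow_succ', Matrix.mul_apply]
    set G : ℤ × ℤ → Matrix (Fin r) (Fin r) ℂ :=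
      fun j => fourierCoeff₂ (fun θ => trigPoly c θ ^ k) j.1 j.2 with hG
    -- The summand of the matrix product, extended to all pairs of a cell and a type. Where `ih`
    -- does not apply, the coefficient `c` in front vanishes.
    let H : (ℤ × ℤ) × Fin r → ℂ := fun w =>
      c ((ι x).1 - w.1) (ι x).2 w.2 * G (w.1 - (ι y).1) w.2 (ι y).2
    have h1 : ∀ z, B x z * (B ^ k) z y = H (ι z) := by
      intro z
      simp only [H, hB]
      by_cases hz : (ι x).1 - (ι z).1 ∈ neighbours
      · rw [ih z]
        intro w hw1 hw2
        rw [mem_neighbours] at hz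
        simp only [Prod.fst_sub, Prod.snd_sub] at hz
        have := hz.1
        have := hz.2
        refine hx w ?_ ?_
        · push_cast
          rw [abs_le] at *
          constructor <;> linarith
        · push_cast
          rw [abs_le] at *
          constructor <;> linarith
      · simp [hc _ hz]
    simp only [h1]
    have h2 : ∀ w, H w ≠ 0 → (ι x).1 - w.1 ∈ neighbours := by
      intro w hw
      by_contra h
      exact hw (by simp [H, hc _ h])
    rw [sum_comp_eq_sum_product hι (S := neighbours.image fun j => (ι x).1 - j),
      Finset.sum_product, Finset.sum_image fun i _ j _ h => sub_right_injective h,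
      Matrix.sum_apply]
    rotate_left
    · intro w hw
      exact Finset.mem_image.2 ⟨_, h2 w hw, sub_sub_cancel _ _⟩
    · intro w hw
      obtain ⟨h3, h4⟩ := mem_neighbours.1 (h2 w hw)
      rw [Prod.fst_sub, abs_sub_comm] at h3
      rw [Prod.snd_sub, abs_sub_comm] at h4
      refine hx w.1 (h3.trans ?_) (h4.trans ?_) w.2 <;> push_cast <;> linarith
    refine Finset.sum_congr rfl fun j _ => ?_
    rw [Matrix.mul_apply]
    refine Finset.sum_congr rfl fun l _ => ?_
    simp only [H, hG, sub_sub_cancel, sub_right_comm _ j (ι y).1]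

end

/-- The mean trace of the powers of sections of a block Laurent operator on boxes, up to the last
layer of blocks. -/
theorem tendsto_trace_pow_section {r : ℕ} {c : ℤ × ℤ → Matrix (Fin r) (Fin r) ℂ}
    (hc : ∀ j ∉ neighbours, c j = 0) {m : ℕ → Type*} [∀ n, Fintype (m n)]
    [∀ n, DecidableEq (m n)] {B : ∀ n, Matrix (m n) (m n) ℂ} {ι : ∀ n, m n → (ℤ × ℤ) × Fin r}
    (hι : ∀ n, Function.Injective (ι n))
    (hB : ∀ n x y, B n x y = c ((ι n x).1 - (ι n y).1) (ι n x).2 (ι n y).2)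
    (hlo : ∀ (n : ℕ) (w : ℤ × ℤ) (s : Fin r), 0 ≤ w.1 → 0 ≤ w.2 → w.1 + 1 < n → w.2 + 1 < n →
      (w, s) ∈ Set.range (ι n))
    (hhi : ∀ (n : ℕ) x, (ι n x).1 ∈ Finset.Ico (0 : ℤ) n ×ˢ Finset.Ico (0 : ℤ) n)
    {C : ℝ} (h0 : 0 ≤ C) (hC : ∀ n i, ∑ j, ‖B n i j‖ ≤ C) (k : ℕ) :
    Tendsto (fun n : ℕ => (B n ^ k).trace / (n : ℂ) ^ 2) atTop
      (𝓝 (fourierCoeff₂ (fun θ => trigPoly c θ ^ k) 0 0).trace) := by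
  set τ := fourierCoeff₂ (fun θ => trigPoly c θ ^ k) 0 0 with hτ
  set M : ℝ := C ^ k + ∑ s, ‖τ s s‖ with hM
  have hM0 : 0 ≤ M := add_nonneg (pow_nonneg h0 k) (Finset.sum_nonneg fun _ _ => norm_nonneg _)
  rw [tendsto_iff_norm_sub_tendsto_zero]
  -- There are `r (n² - (n - 2k - 1)²) ≤ 2 (2k + 1) n r` labels that are not deep, each with error
  -- at most `M`; dividing by `n²` leaves this bound.
  have hz : Tendsto (fun n : ℕ => (2 * (2 * k + 1) * r * M) / (n : ℝ)) atTop (𝓝 0) :=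
    tendsto_const_div_atTop_nhds_zero_nat _
  refine squeeze_zero' (Eventually.of_forall fun _ => norm_nonneg _) ?_ hz
  filter_upwards [eventually_ge_atTop (2 * k + 1)] with n hn
  have hn0 : (n : ℂ) ≠ 0 := by
    have : n ≠ 0 := by omega
    exact_mod_cast this
  set box : Finset (ℤ × ℤ) := Finset.Ico (0 : ℤ) n ×ˢ Finset.Ico (0 : ℤ) n with hbox
  -- Cells whose neighbours up to distance `k` all have coordinates in `[0, n - 1)`. The extra `-1`
  -- discards the last layer, whose blocks may be incomplete.
  set deep : Finset (ℤ × ℤ) :=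
    Finset.Ico (k : ℤ) (n - 1 - k) ×ˢ Finset.Ico (k : ℤ) (n - 1 - k) with hdeep
  -- The diagonal of the power, extended by zero to missing labels, so that it can be compared with
  -- `τ` over the whole box.
  let h : (ℤ × ℤ) × Fin r → ℂ := Function.extend (ι n) (fun x => (B n ^ k) x x) 0
  have hh : ∀ x, h (ι n x) = (B n ^ k) x x := fun x => (hι n).extend_apply _ _ _
  have hr : ∀ w, h w ≠ 0 → w ∈ Set.range (ι n) := by
    intro w hw
    by_contra hcon
    exact hw (Function.extend_apply' _ _ _ hcon)
  have htr : (B n ^ k).trace = ∑ w ∈ box ×ˢ (Finset.univ : Finset (Fin r)), h w := by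
    rw [← sum_comp_eq_sum_product (hι n) (H := h) _ hr]
    · exact Finset.sum_congr rfl fun x _ => (hh x).symm
    · intro w hw
      obtain ⟨x, rfl⟩ := hr w hw
      exact hhi n x
  have hnorm : ∀ w, ‖h w‖ ≤ C ^ k := by
    intro w
    by_cases hw : h w = 0
    · rw [hw, norm_zero]; exact pow_nonneg h0 k
    · obtain ⟨x, rfl⟩ := hr w hw
      rw [hh]
      exact (Finset.single_le_sum (f := fun y => ‖(B n ^ k) x y‖) (fun _ _ => norm_nonneg _)
        (Finset.mem_univ x)).trans (sum_norm_pow_le h0 (hC n) k x)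
  have hτnorm : ∀ s, ‖τ s s‖ ≤ ∑ s, ‖τ s s‖ := fun s =>
    Finset.single_le_sum (f := fun s => ‖τ s s‖) (fun _ _ => norm_nonneg _) (Finset.mem_univ s)
  have hdz : ∀ w ∈ deep ×ˢ (Finset.univ : Finset (Fin r)), h w - τ w.2 w.2 = 0 := by
    rintro ⟨w, s⟩ hw
    simp only [hdeep, Finset.mem_product, Finset.mem_Ico, Finset.mem_univ, and_true] at hw
    obtain ⟨x, hx⟩ := hlo n w s (by omega) (by omega) (by omega) (by omega)
    rw [← hx, hh, pow_section_apply hc (hι n) (hB n) k x x]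
    · rw [sub_self]
      exact sub_self _
    · intro w' h1 h2 s'
      rw [hx] at h1 h2
      simp only [abs_le] at h1 h2
      exact hlo n w' s' (by omega) (by omega) (by omega) (by omega)
  have hsub : deep ×ˢ (Finset.univ : Finset (Fin r)) ⊆ box ×ˢ (Finset.univ : Finset (Fin r)) := by
    rintro ⟨w, s⟩ hw
    simp only [hdeep, hbox, Finset.mem_product, Finset.mem_Ico, Finset.mem_univ,
      and_true] at hw ⊢
    omega
  have hcardbox : (box ×ˢ (Finset.univ : Finset (Fin r))).card = n ^ 2 * r := by
    simp [hbox, Finset.card_product, sq]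
  have hcarddeep : (deep ×ˢ (Finset.univ : Finset (Fin r))).card = (n - 1 - 2 * k) ^ 2 * r := by
    simp only [hdeep, Finset.card_product, Int.card_Ico, Finset.card_univ, Fintype.card_fin]
    have : ((n : ℤ) - 1 - k - k).toNat = n - 1 - 2 * k := by omega
    rw [this, sq]
  have hτsum : (n : ℂ) ^ 2 * τ.trace =
      ∑ w ∈ box ×ˢ (Finset.univ : Finset (Fin r)), τ w.2 w.2 := by
    rw [Finset.sum_product]
    simp only [Finset.sum_const, Matrix.trace, Matrix.diag_apply]
    simp [hbox, sq]
  have hdiff : ‖(B n ^ k).trace - (n : ℂ) ^ 2 * τ.trace‖ ≤ 2 * (2 * k + 1) * n * r * M := by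
    rw [htr, hτsum, ← Finset.sum_sub_distrib, ← Finset.sum_sdiff hsub, Finset.sum_eq_zero hdz,
      add_zero]
    refine (norm_sum_le _ _).trans ?_
    refine (Finset.sum_le_card_nsmul _ _ M fun w _ => ?_).trans ?_
    · exact (norm_sub_le _ _).trans (add_le_add (hnorm w) (hτnorm _))
    · rw [Finset.card_sdiff_of_subset hsub, hcardbox, hcarddeep, nsmul_eq_mul]
      refine mul_le_mul_of_nonneg_right ?_ hM0
      rw [← Nat.sub_mul]
      push_cast
      refine mul_le_mul_of_nonneg_right ?_ (Nat.cast_nonneg r)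
      obtain ⟨l, rfl⟩ : ∃ l, n = l + (2 * k + 1) := ⟨n - (2 * k + 1), by omega⟩
      have e : l + (2 * k + 1) - 1 - 2 * k = l := by omega
      rw [e, Nat.cast_sub (Nat.pow_le_pow_left (by omega) 2)]
      push_cast
      have : (0 : ℝ) ≤ l := Nat.cast_nonneg l
      nlinarith [sq_nonneg (2 * (k : ℝ) + 1)]
  have hn1 : (0 : ℝ) < n := by
    have : 0 < n := by omega
    exact_mod_cast this
  have e : (B n ^ k).trace / (n : ℂ) ^ 2 - τ.trace =
      ((B n ^ k).trace - (n : ℂ) ^ 2 * τ.trace) / (n : ℂ) ^ 2 := by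
    field_simp
  rw [e, norm_div, norm_pow, Complex.norm_natCast, div_le_div_iff₀ (by positivity) hn1]
  calc _ ≤ 2 * (2 * k + 1) * n * r * M * n := mul_le_mul_of_nonneg_right hdiff hn1.le
    _ = _ := by ring

/-- The zeroth coefficient is the mean over the square, so the limit of the normalised traces is a
moment of the symbol. -/
theorem trace_fourierCoeff₂_zero {r : ℕ} {g : ℝ × ℝ → Matrix (Fin r) (Fin r) ℂ}
    (hg : Continuous g) :
    (fourierCoeff₂ g 0 0).trace =
      ((volume fourierSquare).toReal : ℂ)⁻¹ * ∫ θ in fourierSquare, (g θ).trace := by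
  simp only [Matrix.trace, Matrix.diag_apply, fourierCoeff₂, Matrix.of_apply]
  rw [integral_finsetSum, volume_fourierSquare, ENNReal.toReal_ofReal (by positivity),
    Finset.mul_sum]
  · simp
  · intro i _
    exact (hg.matrix_elem i i).continuousOn.integrableOn_compact isCompact_fourierSquare

/-- Hermitian sections of a block Laurent operator with nearest neighbour interaction are spectrally
distributed as its symbol. -/
theorem spectrallyDistributed_section {r : ℕ} (hr : r ≠ 0)
    {c : ℤ × ℤ → Matrix (Fin r) (Fin r) ℂ}
    (hc : ∀ j ∉ neighbours, c j = 0) (hH : ∀ θ, (trigPoly c θ).IsHermitian)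
    {m : ℕ → Type*} [∀ n, Fintype (m n)]
    [∀ n, DecidableEq (m n)] {B : ∀ n, Matrix (m n) (m n) ℂ} {ι : ∀ n, m n → (ℤ × ℤ) × Fin r}
    (hι : ∀ n, Function.Injective (ι n))
    (hB : ∀ n x y, B n x y = c ((ι n x).1 - (ι n y).1) (ι n x).2 (ι n y).2)
    (hBH : ∀ n, (B n).IsHermitian)
    (hlo : ∀ (n : ℕ) (w : ℤ × ℤ) (s : Fin r), 0 ≤ w.1 → 0 ≤ w.2 → w.1 + 1 < n → w.2 + 1 < n →
      (w, s) ∈ Set.range (ι n))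
    (hhi : ∀ (n : ℕ) x, (ι n x).1 ∈ Finset.Ico (0 : ℤ) n ×ˢ Finset.Ico (0 : ℤ) n)
    (hcard : Tendsto (fun n : ℕ => (Fintype.card (m n) : ℂ) / (n : ℂ) ^ 2) atTop (𝓝 (r : ℂ))) :
    SpectrallyDistributed B fourierSquare (trigPoly c) := by
  -- Summing over the rows `i` as well gives one constant for the row sums of the symbol and of
  -- every section.
  set C : ℝ := ∑ i, ∑ j ∈ neighbours, ∑ l, ‖c j i l‖ with hCdef
  have h0 : 0 ≤ C := Finset.sum_nonneg fun _ _ => Finset.sum_nonneg fun _ _ =>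
    Finset.sum_nonneg fun _ _ => norm_nonneg _
  have hrow : ∀ i, ∑ j ∈ neighbours, ∑ l, ‖c j i l‖ ≤ C := fun i =>
    Finset.single_le_sum (f := fun i => ∑ j ∈ neighbours, ∑ l, ‖c j i l‖)
      (fun _ _ => Finset.sum_nonneg fun _ _ => Finset.sum_nonneg fun _ _ => norm_nonneg _)
      (Finset.mem_univ i)
  have hCf : ∀ θ i, ∑ l, ‖trigPoly c θ i l‖ ≤ C := by
    intro θ i
    refine le_trans ?_ (hrow i)
    rw [Finset.sum_comm]
    refine Finset.sum_le_sum fun l _ => ?_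
    simp only [trigPoly, Matrix.sum_apply, Matrix.smul_apply, smul_eq_mul]
    refine (norm_sum_le _ _).trans (Finset.sum_le_sum fun j _ => ?_)
    rw [norm_mul]
    refine mul_le_of_le_one_left (norm_nonneg _) ?_
    unfold character
    rw [Complex.norm_exp]
    simp
  have hCB : ∀ n i, ∑ l, ‖B n i l‖ ≤ C := by
    intro n x
    refine le_trans ?_ (hrow (ι n x).2)
    let H : (ℤ × ℤ) × Fin r → ℝ := fun w => ‖c ((ι n x).1 - w.1) (ι n x).2 w.2‖
    have h1 : ∑ l, ‖B n x l‖ = ∑ w ∈ Finset.univ.image (ι n), H w := by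
      rw [Finset.sum_image fun a _ b _ h => hι n h]
      simp only [hB, H]
    have h2 : ∑ j ∈ neighbours, ∑ l, ‖c j (ι n x).2 l‖ =
        ∑ w ∈ (neighbours.image fun j => (ι n x).1 - j) ×ˢ Finset.univ, H w := by
      rw [Finset.sum_product, Finset.sum_image fun i _ j _ h => sub_right_injective h]
      simp [H]
    rw [h1, h2]
    rw [← Finset.sum_filter_ne_zero]
    refine Finset.sum_le_sum_of_subset_of_nonneg (fun w hw' => ?_) fun _ _ _ => norm_nonneg _
    have hw := (Finset.mem_filter.1 hw').2
    have : (ι n x).1 - w.1 ∈ neighbours := by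
      by_contra h
      exact hw (by simp [H, hc _ h])
    exact Finset.mem_product.2
      ⟨Finset.mem_image.2 ⟨_, this, sub_sub_cancel _ _⟩, Finset.mem_univ _⟩
  have hr' : (r : ℂ) ≠ 0 := by exact_mod_cast hr
  have hcont : ∀ i j, Continuous fun θ => trigPoly c θ i j :=
    fun i j => continuous_trigPoly.matrix_elem i j
  refine spectrallyDistributed_of_moments isCompact_fourierSquare ?_ hcont hH hBH hCf hCB
    fun k => ?_
  · rw [volume_fourierSquare]
    have := Real.pi_pos
    simp only [ENNReal.ofReal_pos]
    positivity
  -- The traces are normalised by `n²`; dividing by the number of indices per cell, which tends to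
  -- `r`, gives the mean over eigenvalues.
  · have h1 := (tendsto_trace_pow_section hc hι hB hlo hhi h0 hCB k).div hcard hr'
    rw [trace_fourierCoeff₂_zero (g := fun θ => trigPoly c θ ^ k) (continuous_trigPoly.pow k)] at h1
    simp only [integral_div]
    rw [mul_div_assoc] at h1
    refine h1.congr' ?_
    filter_upwards [eventually_ne_atTop 0] with n hn
    have : (n : ℂ) ≠ 0 := by exact_mod_cast hn
    simp only [Pi.div_apply]
    rw [div_div_div_cancel_right₀ (pow_ne_zero 2 this), div_eq_inv_mul]

/-! ### The symbol as a trigonometric polynomial -/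

/-- The Fourier coefficients of the symbol of the cubic elements, multiplied by `80`, for one half
of the nonzero frequencies. -/
def symbolHalfTable (j : ℤ × ℤ) : Matrix (Fin 9) (Fin 9) ℤ :=
  if j = (1, 0) then
    !![0, 0, -162, 0, 0, 0, 0, 0, 0;
      0, 0, 27, 0, 0, 27, 0, 0, 6;
      0, 0, 0, 0, 0, 0, 0, 0, -3;
      0, 0, 27, 0, 0, -135, 0, 0, 6;
      0, 0, 0, 0, 0, 0, 0, 0, 0;
      0, 0, 0, 0, 0, 0, 0, 0, -3;
      0, 0, 0, 0, 0, 0, 0, 0, -105;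
      0, 0, 0, 0, 0, 0, 0, 0, 57;
      0, 0, 0, 0, 0, 0, 0, 0, -14]
  else if j = (0, 1) then
    !![0, 0, 0, 0, 0, 0, -162, 0, 0;
      0, 0, 0, 0, 0, 0, 27, -135, 6;
      0, 0, 0, 0, 0, 0, 0, 0, -105;
      0, 0, 0, 0, 0, 0, 27, 27, 6;
      0, 0, 0, 0, 0, 0, 0, 0, 0;
      0, 0, 0, 0, 0, 0, 0, 0, 57;
      0, 0, 0, 0, 0, 0, 0, 0, -3;
      0, 0, 0, 0, 0, 0, 0, 0, -3;
      0, 0, 0, 0, 0, 0, 0, 0, -14]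
  else if j = (1, 1) then
    !![0, 0, 0, 0, 0, 0, 0, 0, 0;
      0, 0, 0, 0, 0, 0, 0, 0, -6;
      0, 0, 0, 0, 0, 0, 0, 0, 0;
      0, 0, 0, 0, 0, 0, 0, 0, -6;
      0, 0, 0, 0, 0, 0, 0, 0, 0;
      0, 0, 0, 0, 0, 0, 0, 0, 0;
      0, 0, 0, 0, 0, 0, 0, 0, 0;
      0, 0, 0, 0, 0, 0, 0, 0, 0;
      0, 0, 0, 0, 0, 0, 0, 0, 0]
  else if j = (-1, 1) then
    !![0, 0, 0, 0, 0, 0, 0, 0, 0;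
      0, 0, 0, 0, 0, 0, 0, 0, 0;
      0, 0, 0, 0, 0, 0, 0, 0, -3;
      0, 0, 0, 0, 0, 0, 0, 0, 0;
      0, 0, 0, 0, 0, 0, 0, 0, 0;
      0, 0, 0, 0, 0, 0, 0, 0, -3;
      0, 0, 0, 0, 0, 0, 0, 0, 0;
      0, 0, 0, 0, 0, 0, 0, 0, 0;
      0, 0, 0, 0, 0, 0, -3, -3, 0]
  else 0

/-- The Fourier coefficients of the symbol of the cubic elements, multiplied by `80`. -/
def symbolTable (j : ℤ × ℤ) : Matrix (Fin 9) (Fin 9) ℤ :=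
  if j = 0 then
    !![648, -162, 0, -162, 0, 0, 0, 0, 0;
      -162, 540, -135, -108, -162, 27, 27, 27, -6;
      0, -135, 540, 27, 0, -270, 0, 0, 57;
      -162, -108, 27, 540, -162, 27, -135, 27, -6;
      0, -162, 0, -162, 648, -162, 0, -162, 0;
      0, 27, -270, 27, -162, 540, 0, 0, -105;
      0, 27, 0, -135, 0, 0, 540, -270, 57;
      0, 27, 0, 27, -162, 0, -270, 540, -105;
      0, -6, 57, -6, 0, -105, 57, -105, 272]
  else symbolHalfTable j + (symbolHalfTable (-j)).transpose

/-- The Fourier coefficients of the symbol of the cubic elements. -/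
noncomputable def symbolCoeff (j : ℤ × ℤ) : Matrix (Fin 9) (Fin 9) ℂ :=
  (symbolTable j).map fun z => (z : ℂ) / 80

/-- This is the Hermitian symmetry of the symbol in integer form. Off the origin it is built into
the definition, as transposing swaps the two summands. -/
theorem symbolTable_neg (j : ℤ × ℤ) : symbolTable (-j) = (symbolTable j).transpose := by
  unfold symbolTable
  by_cases h : j = 0
  · subst h
    simp only [neg_zero, if_true]
    decide
  · rw [if_neg h, if_neg (neg_ne_zero.2 h), neg_neg, Matrix.transpose_add,
      Matrix.transpose_transpose, add_comm]

theorem symbolTable_eq_zero {j : ℤ × ℤ} (hj : j ∉ neighbours) : symbolTable j = 0 := by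
  unfold symbolTable symbolHalfTable
  rw [mem_neighbours] at hj
  have : ∀ l : ℤ × ℤ, |l.1| ≤ 1 ∧ |l.2| ≤ 1 → j ≠ l := by
    rintro l hl rfl
    exact hj hl
  have h0 := this 0 (by simp)
  have h1 := this (1, 0) (by simp)
  have h2 := this (0, 1) (by simp)
  have h3 := this (1, 1) (by simp)
  have h4 := this (-1, 1) (by simp)
  have h5 : -j ≠ (1, 0) := fun h => this (-1, 0) (by simp) (by rw [← neg_neg j, h]; rfl)
  have h6 : -j ≠ (0, 1) := fun h => this (0, -1) (by simp) (by rw [← neg_neg j, h]; rfl)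
  have h7 : -j ≠ (1, 1) := fun h => this (-1, -1) (by simp) (by rw [← neg_neg j, h]; rfl)
  have h8 : -j ≠ (-1, 1) := fun h => this (1, -1) (by simp) (by rw [← neg_neg j, h]; rfl)
  simp only [if_neg h0, if_neg h1, if_neg h2, if_neg h3, if_neg h4, if_neg h5, if_neg h6,
    if_neg h7, if_neg h8]
  simp

theorem symbolCoeff_eq_zero {j : ℤ × ℤ} (hj : j ∉ neighbours) : symbolCoeff j = 0 := by
  ext a b
  simp [symbolCoeff, symbolTable_eq_zero hj]

theorem conj_character (j : ℤ × ℤ) (θ : ℝ × ℝ) :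
    starRingEnd ℂ (character j θ) = character (-j) θ := by
  unfold character
  rw [← Complex.exp_conj]
  congr 1
  simp
  ring

theorem neg_mem_neighbours {j : ℤ × ℤ} (hj : j ∈ neighbours) : -j ∈ neighbours := by
  rw [mem_neighbours] at hj ⊢
  simpa using hj

/-- Conjugate transposition exchanges the terms of the frequencies `j` and `-j`. -/
theorem isHermitian_trigPoly_symbolCoeff (θ : ℝ × ℝ) : (trigPoly symbolCoeff θ).IsHermitian := by
  unfold trigPoly Matrix.IsHermitian
  rw [Matrix.conjTranspose_sum]
  refine Finset.sum_bij' (fun j _ => -j) (fun j _ => -j) (fun j hj => neg_mem_neighbours hj)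
    (fun j hj => neg_mem_neighbours hj) (fun j _ => neg_neg j) (fun j _ => neg_neg j)
    fun j _ => ?_
  rw [Matrix.conjTranspose_smul, ← conj_character]
  congr 1
  ext a b
  simp [symbolCoeff, symbolTable_neg]

theorem character_eq (j : ℤ × ℤ) (θ : ℝ × ℝ) : character j θ =
    Complex.exp (Complex.I * (θ.1 : ℂ)) ^ j.1 * Complex.exp (Complex.I * (θ.2 : ℂ)) ^ j.2 := by
  unfold character
  rw [← Complex.exp_int_mul, ← Complex.exp_int_mul, ← Complex.exp_add]
  congr 1
  ring

theorem trigPoly_symbolCoeff_apply (θ : ℝ × ℝ) (a b : Fin 9) :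
    trigPoly symbolCoeff θ a b =
      (let e₁ : ℂ := Complex.exp (Complex.I * (θ.1 : ℂ))
       let e₂ : ℂ := Complex.exp (Complex.I * (θ.2 : ℂ))
       ((symbolTable 0 a b : ℤ) : ℂ) / 80 +
       (symbolHalfTable (1, 0) a b / 80 * e₁ + symbolHalfTable (1, 0) b a / 80 * e₁⁻¹) +
       (symbolHalfTable (0, 1) a b / 80 * e₂ + symbolHalfTable (0, 1) b a / 80 * e₂⁻¹) +
       (symbolHalfTable (1, 1) a b / 80 * (e₁ * e₂) +
         symbolHalfTable (1, 1) b a / 80 * (e₁⁻¹ * e₂⁻¹)) +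
       (symbolHalfTable (-1, 1) a b / 80 * (e₁⁻¹ * e₂) +
         symbolHalfTable (-1, 1) b a / 80 * (e₁ * e₂⁻¹))) := by
  have h0 : ∀ j : ℤ × ℤ, j ∈ ({(1, 0), (0, 1), (1, 1), (-1, 1)} : Finset (ℤ × ℤ)) →
      symbolTable j = symbolHalfTable j ∧ symbolTable (-j) = (symbolHalfTable j).transpose := by
    decide +kernel
  have h1 := h0 (1, 0) (by decide)
  have h2 := h0 (0, 1) (by decide)
  have h3 := h0 (1, 1) (by decide)
  have h4 := h0 (-1, 1) (by decide)
  have n1 : ((-1, 0) : ℤ × ℤ) = -(1, 0) := rfl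
  have n2 : ((0, -1) : ℤ × ℤ) = -(0, 1) := rfl
  have n3 : ((-1, -1) : ℤ × ℤ) = -(1, 1) := rfl
  have n4 : ((1, -1) : ℤ × ℤ) = -(-1, 1) := rfl
  have n0 : ((0, 0) : ℤ × ℤ) = 0 := rfl
  have hs : ∀ g : ℤ × ℤ → ℂ, ∑ j ∈ neighbours, g j = g (0, 0) + (g (1, 0) + g (-1, 0)) +
      (g (0, 1) + g (0, -1)) + (g (1, 1) + g (-1, -1)) + (g (-1, 1) + g (1, -1)) := by
    intro g
    unfold neighbours
    rw [Finset.sum_product]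
    simp
    ring
  unfold trigPoly
  rw [Matrix.sum_apply, hs]
  simp only [Matrix.smul_apply, smul_eq_mul, character_eq, zpow_zero, zpow_one, zpow_neg_one,
    mul_one, one_mul, symbolCoeff, Matrix.map_apply]
  rw [n0, n1, n2, n3, n4, h1.2, h2.2, h3.2, h4.2, h1.1, h2.1, h3.1, h4.1]
  simp only [Matrix.transpose_apply]
  ring

-- Conjugation inverts `e₁` and `e₂`, and the cosines are half sums of exponentials. Each of the 81
-- entries thus becomes an identity of Laurent polynomials in `e₁` and `e₂`.
set_option maxHeartbeats 2000000 in
theorem symbolP3_eq : symbolP3 = trigPoly symbolCoeff := by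
  ext θ a b
  rw [trigPoly_symbolCoeff_apply]
  have hc : ∀ t : ℝ, starRingEnd ℂ (Complex.exp (Complex.I * (t : ℂ))) =
      (Complex.exp (Complex.I * (t : ℂ)))⁻¹ := by
    intro t
    rw [← Complex.exp_conj, ← Complex.exp_neg]
    simp
  have hcos : ∀ t : ℝ, Complex.cos (t : ℂ) = (Complex.exp (Complex.I * (t : ℂ)) +
      (Complex.exp (Complex.I * (t : ℂ)))⁻¹) / 2 := by
    intro t
    rw [← Complex.exp_neg, Complex.cos, mul_comm, neg_mul, mul_comm Complex.I]
  unfold symbolP3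
  simp only [Complex.exp_neg, hcos]
  have h1 := hc θ.1
  have h2 := hc θ.2
  generalize Complex.exp (Complex.I * (θ.1 : ℂ)) = e₁ at *
  generalize Complex.exp (Complex.I * (θ.2 : ℂ)) = e₂ at *
  fin_cases a <;> fin_cases b <;>
    simp [symbolTable, symbolHalfTable, h1, h2, map_ofNat, -mul_eq_mul_right_iff] <;> ring

/-! ### The cubic nodal basis on the triangles -/

/-- The open reference triangle. -/
def refTriangle : Set (ℝ × ℝ) := {y | 0 < y.1 ∧ 0 < y.2 ∧ y.1 + y.2 < 1}

/-- The cubic shape function of the node `(a / 3, b / 3)` of the reference triangle. It is zero for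
the other pairs of integers. -/
noncomputable def shape (p : ℤ × ℤ) (y : ℝ × ℝ) : ℝ :=
  if 0 ≤ p.1 ∧ 0 ≤ p.2 ∧ p.1 + p.2 ≤ 3 then
    lagrangeFactor p.1.toNat (3 * y.1) * lagrangeFactor p.2.toNat (3 * y.2) *
      lagrangeFactor (3 - p.1 - p.2).toNat (3 * (1 - y.1 - y.2))
  else 0

/-- The reference coordinates of the triangle with the right angle at the vertex `V`, which lies
above and to the right of `V` for `σ = 1`, and below and to the left for `σ = -1`. -/
noncomputable def localCoord (n : ℕ) (σ : ℤ) (V : ℕ × ℕ) (x : ℝ × ℝ) : ℝ × ℝ :=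
  (σ * (n * x.1 - V.1), σ * (n * x.2 - V.2))

/-- The reference coordinates of a node, multiplied by `3`. -/
def localNode {n : ℕ} (σ : ℤ) (V : ℕ × ℕ) (p : NodeIndex n) : ℤ × ℤ :=
  (σ * (((p.1 : ℕ) : ℤ) + 1 - 3 * V.1), σ * (((p.2 : ℕ) : ℤ) + 1 - 3 * V.2))

/-- The open triangle with the right angle at the vertex `V`. -/
def openTriangle (n : ℕ) (σ : ℤ) (V : ℕ × ℕ) : Set (ℝ × ℝ) := localCoord n σ V ⁻¹' refTriangle

/-- The vertices `V`, `V₁`, `V₂` form a triangle of the mesh with the right angle at `V`. -/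
structure IsElement (n : ℕ) (σ : ℤ) (V V₁ V₂ : ℕ × ℕ) : Prop where
  sign : σ = 1 ∨ σ = -1
  fst₁ : (V₁.1 : ℤ) = V.1 + σ
  snd₁ : V₁.2 = V.2
  fst₂ : V₂.1 = V.1
  snd₂ : (V₂.2 : ℤ) = V.2 + σ
  le : V.1 ≤ n ∧ V.2 ≤ n
  le₁ : V₁.1 ≤ n
  le₂ : V₂.2 ≤ n

section

variable {n : ℕ} {σ : ℤ} {V V₁ V₂ : ℕ × ℕ}

/-- The hat functions of the three vertices are the barycentric coordinates. In the maximum that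
defines `hat`, the term with the sum dominates for the vertex at the right angle, and one coordinate
term for each of the other two. -/
theorem hat_right_angle (h : IsElement n σ V V₁ V₂) {x : ℝ × ℝ} (hx : x ∈ openTriangle n σ V) :
    hat n V x = 1 - (localCoord n σ V x).1 - (localCoord n σ V x).2 := by
  obtain ⟨h1, h2, h3⟩ := hx
  simp only [localCoord] at *
  rcases h.sign with rfl | rfl
  all_goals
    push_cast at *
    refine hat_eq (by linarith) (abs_le.2 ⟨?_, ?_⟩) (abs_le.2 ⟨?_, ?_⟩) (abs_le.2 ⟨?_, ?_⟩)
      (Or.inr (Or.inr (le_abs.2 ?_)))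
    any_goals linarith
  · left; linarith
  · right; linarith

theorem hat_first (h : IsElement n σ V V₁ V₂) {x : ℝ × ℝ} (hx : x ∈ openTriangle n σ V) :
    hat n V₁ x = (localCoord n σ V x).1 := by
  obtain ⟨h1, h2, h3⟩ := hx
  have e1 : (V₁.1 : ℝ) = V.1 + σ := by exact_mod_cast h.fst₁
  have e2 := h.snd₁
  simp only [localCoord] at *
  rcases h.sign with rfl | rfl
  all_goals
    push_cast at *
    refine hat_eq (by linarith) (abs_le.2 ⟨?_, ?_⟩) (abs_le.2 ⟨?_, ?_⟩) (abs_le.2 ⟨?_, ?_⟩)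
      (Or.inl (le_abs.2 ?_)) <;> simp only [e1, e2]
    any_goals linarith
  · right; linarith
  · left; linarith

theorem hat_second (h : IsElement n σ V V₁ V₂) {x : ℝ × ℝ} (hx : x ∈ openTriangle n σ V) :
    hat n V₂ x = (localCoord n σ V x).2 := by
  obtain ⟨h1, h2, h3⟩ := hx
  have e1 := h.fst₂
  have e2 : (V₂.2 : ℝ) = V.2 + σ := by exact_mod_cast h.snd₂
  simp only [localCoord] at *
  rcases h.sign with rfl | rfl
  all_goals
    push_cast at *
    refine hat_eq (by linarith) (abs_le.2 ⟨?_, ?_⟩) (abs_le.2 ⟨?_, ?_⟩) (abs_le.2 ⟨?_, ?_⟩)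
      (Or.inr (Or.inl (le_abs.2 ?_))) <;> simp only [e1, e2]
    any_goals linarith
  · right; linarith
  · left; linarith

/-- A lattice point that is not a vertex of the triangle satisfies one of five integer inequalities,
and each makes one of the terms in `hat` at least `1` on the triangle. -/
theorem hat_other (h : IsElement n σ V V₁ V₂) {x : ℝ × ℝ} (hx : x ∈ openTriangle n σ V)
    {W : ℕ × ℕ} (hW : W ∉ ({V, V₁, V₂} : Finset (ℕ × ℕ))) : hat n W x = 0 := by
  obtain ⟨h1, h2, h3⟩ := hx
  simp only [Finset.mem_insert, Finset.mem_singleton, Prod.ext_iff] at hW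
  have g1 := h.fst₁
  have g2 := h.snd₁
  have g3 := h.fst₂
  have g4 := h.snd₂
  apply hat_eq_zero
  simp only [le_abs]
  simp only [localCoord] at *
  rcases h.sign with rfl | rfl
  · have hcase : W.1 + 1 ≤ V.1 ∨ V.1 + 2 ≤ W.1 ∨ W.2 + 1 ≤ V.2 ∨ V.2 + 2 ≤ W.2 ∨
        V.1 + V.2 + 2 ≤ W.1 + W.2 := by omega
    push_cast at *
    rcases hcase with h | h | h | h | h
    · have : (W.1 : ℝ) + 1 ≤ V.1 := by exact_mod_cast h
      left; left; linarith
    · have : (V.1 : ℝ) + 2 ≤ W.1 := by exact_mod_cast h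
      left; right; linarith
    · have : (W.2 : ℝ) + 1 ≤ V.2 := by exact_mod_cast h
      right; left; left; linarith
    · have : (V.2 : ℝ) + 2 ≤ W.2 := by exact_mod_cast h
      right; left; right; linarith
    · have : (V.1 : ℝ) + V.2 + 2 ≤ W.1 + W.2 := by exact_mod_cast h
      right; right; right; linarith
  · have hcase : V.1 + 1 ≤ W.1 ∨ W.1 + 2 ≤ V.1 ∨ V.2 + 1 ≤ W.2 ∨ W.2 + 2 ≤ V.2 ∨
        W.1 + W.2 + 2 ≤ V.1 + V.2 := by omega
    push_cast at *
    rcases hcase with h | h | h | h | h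
    · have : (V.1 : ℝ) + 1 ≤ W.1 := by exact_mod_cast h
      left; right; linarith
    · have : (W.1 : ℝ) + 2 ≤ V.1 := by exact_mod_cast h
      left; left; linarith
    · have : (V.2 : ℝ) + 1 ≤ W.2 := by exact_mod_cast h
      right; left; right; linarith
    · have : (W.2 : ℝ) + 2 ≤ V.2 := by exact_mod_cast h
      right; left; left; linarith
    · have : (W.1 : ℝ) + W.2 + 2 ≤ V.1 + V.2 := by exact_mod_cast h
      right; right; left; linarith

theorem nodeWeight_ne_zero {a b : ℕ} {W : ℕ × ℕ} (h1 : a < 3 * W.1 + 3) (h2 : 3 * W.1 < a + 3)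
    (h3 : b < 3 * W.2 + 3) (h4 : 3 * W.2 < b + 3) (h5 : a + b < 3 * W.1 + 3 * W.2 + 3)
    (h6 : 3 * W.1 + 3 * W.2 < a + b + 3) : nodeWeight a b W ≠ 0 := by
  unfold nodeWeight
  omega

/-- A node with nonzero weights only at the vertices of a triangle lies on this triangle. -/
theorem localNode_mem (h : IsElement n σ V V₁ V₂) (p : NodeIndex n)
    (hp : ∀ W : ℕ × ℕ, W.1 ≤ n → W.2 ≤ n →
      nodeWeight ((p.1 : ℕ) + 1) ((p.2 : ℕ) + 1) W ≠ 0 → W ∈ ({V, V₁, V₂} : Finset (ℕ × ℕ))) :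
    0 ≤ (localNode σ V p).1 ∧ 0 ≤ (localNode σ V p).2 ∧
      (localNode σ V p).1 + (localNode σ V p).2 ≤ 3 := by
  have h1 := p.1.2
  have h2 := p.2.2
  have g1 := h.fst₁
  have g2 := h.snd₁
  have g3 := h.fst₂
  have g4 := h.snd₂
  have hs := h.sign
  simp only [localNode]
  generalize ((p.1 : ℕ)) = a at *
  generalize ((p.2 : ℕ)) = b at *
  obtain ⟨c, v, hv, ha⟩ : ∃ c v, v < 3 ∧ a + 1 = 3 * c + v :=
    ⟨(a + 1) / 3, (a + 1) % 3, by omega, by omega⟩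
  obtain ⟨d, w, hw, hb⟩ : ∃ d w, w < 3 ∧ b + 1 = 3 * d + w :=
    ⟨(b + 1) / 3, (b + 1) % 3, by omega, by omega⟩
  simp only [Finset.mem_insert, Finset.mem_singleton, Prod.ext_iff] at hp
  have ha' : (a : ℤ) + 1 = 3 * c + v := by exact_mod_cast ha
  have hb' : (b : ℤ) + 1 = 3 * d + w := by exact_mod_cast hb
  rw [ha, hb] at hp
  rw [ha', hb']
  have key : ∀ i j : ℕ, i ≤ n → j ≤ n → 3 * c + v < 3 * i + 3 → 3 * i < 3 * c + v + 3 →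
      3 * d + w < 3 * j + 3 → 3 * j < 3 * d + w + 3 →
      3 * c + v + (3 * d + w) < 3 * i + 3 * j + 3 →
      3 * i + 3 * j < 3 * c + v + (3 * d + w) + 3 →
      ((i : ℤ) = V.1 ∧ (j : ℤ) = V.2 ∨ (i : ℤ) = V.1 + σ ∧ (j : ℤ) = V.2 ∨
        (i : ℤ) = V.1 ∧ (j : ℤ) = V.2 + σ) := by
    intro i j hi hj k1 k2 k3 k4 k5 k6
    have := hp (i, j) hi hj (nodeWeight_ne_zero k1 k2 k3 k4 k5 k6)
    simp only at this
    rcases this with h | h | h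
    · left; omega
    · right; left; omega
    · right; right; omega
  clear hp g1 g2 g3 g4 h
  generalize (V.1 : ℤ) = X at *
  generalize (V.2 : ℤ) = Y at *
  -- The node lies in the lower triangle of the cell `(c, d)`, with weights `3 - v - w`, `v`, `w`,
  -- or else `v = w = 2` and it lies in the upper triangle with all weights `1`. Every vertex of
  -- positive weight must be one of `V`, `V₁`, `V₂`.
  by_cases hsum : v + w ≤ 3
  · have A : v + w < 3 → _ := fun hlt => key c d (by omega) (by omega) (by omega) (by omega)
      (by omega) (by omega) (by omega) (by omega)
    have B : 0 < v → _ := fun hlt => key (c + 1) d (by omega) (by omega) (by omega) (by omega)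
      (by omega) (by omega) (by omega) (by omega)
    have C : 0 < w → _ := fun hlt => key c (d + 1) (by omega) (by omega) (by omega) (by omega)
      (by omega) (by omega) (by omega) (by omega)
    clear key
    push_cast at A B C
    rcases hs with rfl | rfl <;> interval_cases v <;> interval_cases w <;> omega
  · have B := key (c + 1) d (by omega) (by omega) (by omega) (by omega)
      (by omega) (by omega) (by omega) (by omega)
    have C := key c (d + 1) (by omega) (by omega) (by omega) (by omega)
      (by omega) (by omega) (by omega) (by omega)
    have D := key (c + 1) (d + 1) (by omega) (by omega) (by omega) (by omega)
      (by omega) (by omega) (by omega) (by omega)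
    clear key
    push_cast at B C D
    rcases hs with rfl | rfl <;> interval_cases v <;> interval_cases w <;> omega

theorem nodeWeight_of_mem (h : IsElement n σ V V₁ V₂) (p : NodeIndex n)
    (hp : 0 ≤ (localNode σ V p).1 ∧ 0 ≤ (localNode σ V p).2 ∧
      (localNode σ V p).1 + (localNode σ V p).2 ≤ 3) :
    nodeWeight ((p.1 : ℕ) + 1) ((p.2 : ℕ) + 1) V =
        (3 - (localNode σ V p).1 - (localNode σ V p).2).toNat ∧
      nodeWeight ((p.1 : ℕ) + 1) ((p.2 : ℕ) + 1) V₁ = (localNode σ V p).1.toNat ∧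
      nodeWeight ((p.1 : ℕ) + 1) ((p.2 : ℕ) + 1) V₂ = (localNode σ V p).2.toNat ∧
      ∀ W ∉ ({V, V₁, V₂} : Finset (ℕ × ℕ)),
        nodeWeight ((p.1 : ℕ) + 1) ((p.2 : ℕ) + 1) W = 0 := by
  have g1 := h.fst₁
  have g2 := h.snd₁
  have g3 := h.fst₂
  have g4 := h.snd₂
  have hs := h.sign
  simp only [localNode] at *
  generalize ((p.1 : ℕ)) = a at *
  generalize ((p.2 : ℕ)) = b at *
  unfold nodeWeight
  refine ⟨?_, ?_, ?_, ?_⟩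
  · rcases hs with rfl | rfl <;> push_cast <;> omega
  · rcases hs with rfl | rfl <;> push_cast <;> omega
  · rcases hs with rfl | rfl <;> push_cast <;> omega
  · intro W hW
    simp only [Finset.mem_insert, Finset.mem_singleton, Prod.ext_iff] at hW
    rcases hs with rfl | rfl <;> push_cast <;> omega

/-- If the node lies on the closed triangle, only the factors of the three vertices differ from `1`.
Otherwise some vertex off the triangle has positive weight, and its hat function vanishes on the
triangle, so both sides are zero. -/
theorem cubicBasisFun_eq_shape (h : IsElement n σ V V₁ V₂) (p : NodeIndex n) {x : ℝ × ℝ}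
    (hx : x ∈ openTriangle n σ V) :
    cubicBasisFun n p x = shape (localNode σ V p) (localCoord n σ V x) := by
  unfold shape
  split_ifs with hp
  · obtain ⟨w0, w1, w2, w3⟩ := nodeWeight_of_mem h p hp
    unfold cubicBasisFun
    have hS : ({V, V₁, V₂} : Finset (ℕ × ℕ)) ⊆ Finset.range (n + 1) ×ˢ Finset.range (n + 1) := by
      intro W hW
      have := h.le
      have := h.le₁
      have := h.le₂
      have := h.snd₁
      have := h.fst₂
      simp only [Finset.mem_insert, Finset.mem_singleton] at hW
      rcases hW with rfl | rfl | rfl <;> simp <;> omega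
    have hne1 : V ∉ ({V₁, V₂} : Finset (ℕ × ℕ)) := by
      have g1 := h.fst₁
      have g4 := h.snd₂
      simp only [Finset.mem_insert, Finset.mem_singleton, Prod.ext_iff]
      rcases h.sign with rfl | rfl <;> omega
    have hne2 : V₁ ∉ ({V₂} : Finset (ℕ × ℕ)) := by
      have g1 := h.fst₁
      have g3 := h.fst₂
      simp only [Finset.mem_singleton, Prod.ext_iff]
      rcases h.sign with rfl | rfl <;> omega
    rw [← Finset.prod_subset hS fun W _ hW => by rw [w3 W hW, lagrangeFactor_zero],
      Finset.prod_insert hne1, Finset.prod_insert hne2, Finset.prod_singleton, w0, w1, w2,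
      hat_right_angle h hx, hat_first h hx, hat_second h hx]
    ring
  · have := mt (localNode_mem h p) hp
    push Not at this
    obtain ⟨W, hW1, hW2, hW3, hW4⟩ := this
    exact cubicBasisFun_eq_zero p hW1 hW2 hW3 (hat_other h hx hW4)

end

/-! ### Decomposition of the stiffness matrix into element contributions -/

theorem contDiff_shape (p : ℤ × ℤ) : ContDiff ℝ 1 (shape p) := by
  have hl : ∀ m : ℕ, ContDiff ℝ 1 (lagrangeFactor m) := by
    intro m
    unfold lagrangeFactor
    exact contDiff_prod fun l _ => by fun_prop
  unfold shape
  split_ifs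
  · have h1 := hl p.1.toNat
    have h2 := hl p.2.toNat
    have h3 := hl (3 - p.1 - p.2).toNat
    fun_prop
  · exact contDiff_const

theorem continuous_gradDot_shape (p q : ℤ × ℤ) : Continuous (gradDot (shape p) (shape q)) := by
  have h1 := (contDiff_shape p).continuous_fderiv one_ne_zero
  have h2 := (contDiff_shape q).continuous_fderiv one_ne_zero
  unfold gradDot
  fun_prop

theorem isOpen_refTriangle : IsOpen refTriangle := by
  have h1 : IsOpen {y : ℝ × ℝ | 0 < y.1} := isOpen_lt continuous_const continuous_fst
  have h2 : IsOpen {y : ℝ × ℝ | 0 < y.2} := isOpen_lt continuous_const continuous_snd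
  have h3 : IsOpen {y : ℝ × ℝ | y.1 + y.2 < 1} :=
    isOpen_lt (continuous_fst.add continuous_snd) continuous_const
  exact h1.inter (h2.inter h3)

section

variable {n : ℕ} {σ : ℤ} {V V₁ V₂ : ℕ × ℕ}

theorem localCoord_eq (x : ℝ × ℝ) : localCoord n σ V x =
    ((σ : ℝ) * n) • x - ((σ : ℝ) * V.1, (σ : ℝ) * V.2) := by
  ext <;> simp [localCoord] <;> ring

theorem hasFDerivAt_localCoord (x : ℝ × ℝ) : HasFDerivAt (localCoord n σ V)
    (((σ : ℝ) * n) • ContinuousLinearMap.id ℝ (ℝ × ℝ)) x := by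
  have : localCoord n σ V = fun x => ((σ : ℝ) * n) • x - ((σ : ℝ) * V.1, (σ : ℝ) * V.2) :=
    funext localCoord_eq
  rw [this]
  exact ((hasFDerivAt_id (𝕜 := ℝ) x).const_smul ((σ : ℝ) * n)).sub_const _

theorem continuous_localCoord : Continuous (localCoord n σ V) :=
  continuous_iff_continuousAt.2 fun x => (hasFDerivAt_localCoord x).continuousAt

theorem isOpen_openTriangle : IsOpen (openTriangle n σ V) :=
  isOpen_refTriangle.preimage continuous_localCoord

theorem fderiv_cubicBasis (h : IsElement n σ V V₁ V₂) (p : NodeIndex n) {x : ℝ × ℝ}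
    (hx : x ∈ openTriangle n σ V) (v : ℝ × ℝ) :
    fderiv ℝ (cubicBasis n p : ℝ × ℝ → ℝ) x v =
      (σ : ℝ) * n * fderiv ℝ (shape (localNode σ V p)) (localCoord n σ V x) v := by
  have he : (cubicBasis n p : ℝ × ℝ → ℝ) =ᶠ[𝓝 x] shape (localNode σ V p) ∘ localCoord n σ V := by
    filter_upwards [isOpen_openTriangle.mem_nhds hx] with z hz
    exact cubicBasisFun_eq_shape h p hz
  have hd := ((contDiff_shape (localNode σ V p)).differentiable one_ne_zero
    (localCoord n σ V x)).hasFDerivAt.comp x (hasFDerivAt_localCoord (n := n) (σ := σ) (V := V) x)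
  rw [he.fderiv_eq, hd.fderiv]
  simp

theorem gradDot_cubicBasis (h : IsElement n σ V V₁ V₂) (p q : NodeIndex n) {x : ℝ × ℝ}
    (hx : x ∈ openTriangle n σ V) :
    gradDot (cubicBasis n q) (cubicBasis n p) x =
      ((σ : ℝ) * n) ^ 2 *
        gradDot (shape (localNode σ V q)) (shape (localNode σ V p)) (localCoord n σ V x) := by
  unfold gradDot
  simp only [fderiv_cubicBasis h _ hx]
  ring

/-- The Jacobian of the scaling cancels the factor `(σ n)²` that comes from two gradients. This is
why element matrices in dimension two do not depend on `n`. -/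
theorem integral_openTriangle (hσ : σ ≠ 0) (hn : n ≠ 0) (G : ℝ × ℝ → ℝ) :
    ∫ x in openTriangle n σ V, ((σ : ℝ) * n) ^ 2 * G (localCoord n σ V x) =
      ∫ y in refTriangle, G y := by
  have hR : (σ : ℝ) * n ≠ 0 := mul_ne_zero (by exact_mod_cast hσ) (by exact_mod_cast hn)
  rw [integral_const_mul, ← integral_indicator isOpen_openTriangle.measurableSet,
    ← integral_indicator isOpen_refTriangle.measurableSet]
  have e : (openTriangle n σ V).indicator (fun x => G (localCoord n σ V x)) =
      fun x => (fun y => refTriangle.indicator G (y - ((σ : ℝ) * V.1, (σ : ℝ) * V.2)))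
        (((σ : ℝ) * n) • x) := by
    ext x
    simp only [← localCoord_eq]
    rfl
  rw [e, Measure.integral_comp_smul, integral_sub_right_eq_self]
  simp only [Module.finrank_prod, Module.finrank_self, Nat.reduceAdd, smul_eq_mul]
  rw [abs_of_nonneg (by positivity), mul_inv_cancel_left₀ (pow_ne_zero 2 hR)]

theorem openTriangle_subset (hn : n ≠ 0) (h : IsElement n σ V V₁ V₂) :
    openTriangle n σ V ⊆ unitSquare := by
  rintro x ⟨h1, h2, h3⟩
  have hn' : (0 : ℝ) < n := by exact_mod_cast Nat.pos_of_ne_zero hn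
  have g1 := h.fst₁
  have g4 := h.snd₂
  have l0 := h.le
  have l1 := h.le₁
  have l2 := h.le₂
  simp only [localCoord] at h1 h2 h3
  rcases h.sign with rfl | rfl
  · have a1 : ((V.1 : ℕ) : ℝ) + 1 ≤ n := by
      have : V.1 + 1 ≤ n := by omega
      exact_mod_cast this
    have a2 : ((V.2 : ℕ) : ℝ) + 1 ≤ n := by
      have : V.2 + 1 ≤ n := by omega
      exact_mod_cast this
    have b1 : (0 : ℝ) ≤ V.1 := Nat.cast_nonneg _
    have b2 : (0 : ℝ) ≤ V.2 := Nat.cast_nonneg _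
    push_cast at h1 h2 h3
    refine ⟨⟨?_, ?_⟩, ⟨?_, ?_⟩⟩ <;> by_contra hcon <;> push Not at hcon <;> nlinarith
  · have a1 : (1 : ℝ) ≤ V.1 := by
      have : 1 ≤ V.1 := by omega
      exact_mod_cast this
    have a2 : (1 : ℝ) ≤ V.2 := by
      have : 1 ≤ V.2 := by omega
      exact_mod_cast this
    have b1 : (V.1 : ℝ) ≤ n := by exact_mod_cast l0.1
    have b2 : (V.2 : ℝ) ≤ n := by exact_mod_cast l0.2
    push_cast at h1 h2 h3
    refine ⟨⟨?_, ?_⟩, ⟨?_, ?_⟩⟩ <;> by_contra hcon <;> push Not at hcon <;> nlinarith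

theorem integrableOn_gradDot_cubicBasis (hn : n ≠ 0) (h : IsElement n σ V V₁ V₂)
    (p q : NodeIndex n) :
    IntegrableOn (gradDot (cubicBasis n q) (cubicBasis n p)) (openTriangle n σ V) := by
  have hc : Continuous fun x => ((σ : ℝ) * n) ^ 2 *
      gradDot (shape (localNode σ V q)) (shape (localNode σ V p)) (localCoord n σ V x) :=
    continuous_const.mul ((continuous_gradDot_shape _ _).comp continuous_localCoord)
  have h1 : IntegrableOn (fun x => ((σ : ℝ) * n) ^ 2 *
      gradDot (shape (localNode σ V q)) (shape (localNode σ V p)) (localCoord n σ V x))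
      (openTriangle n σ V) := by
    refine (hc.continuousOn.integrableOn_compact
      (K := Set.Icc (0 : ℝ) 1 ×ˢ Set.Icc (0 : ℝ) 1) (isCompact_Icc.prod isCompact_Icc)).mono_set ?_
    exact (openTriangle_subset hn h).trans
      (Set.prod_mono Set.Ioo_subset_Icc_self Set.Ioo_subset_Icc_self)
  exact h1.congr_fun (fun x hx => (gradDot_cubicBasis h p q hx).symm)
    isOpen_openTriangle.measurableSet

end

/-- The entries of the stiffness matrix of the reference triangle. -/
noncomputable def refStiffness (p q : ℤ × ℤ) : ℝ :=
  ∫ y in refTriangle, gradDot (shape q) (shape p) y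

theorem integral_gradDot_cubicBasis {n : ℕ} {σ : ℤ} {V V₁ V₂ : ℕ × ℕ} (hn : n ≠ 0)
    (h : IsElement n σ V V₁ V₂) (p q : NodeIndex n) :
    ∫ x in openTriangle n σ V, gradDot (cubicBasis n q) (cubicBasis n p) x =
      refStiffness (localNode σ V p) (localNode σ V q) := by
  have hσ : σ ≠ 0 := by
    rcases h.sign with rfl | rfl <;> decide
  rw [refStiffness, ← integral_openTriangle (V := V) hσ hn]
  exact setIntegral_congr_fun isOpen_openTriangle.measurableSet
    fun x hx => gradDot_cubicBasis h p q hx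

/-- The open triangles of the mesh. The cell is given by its lower left corner. -/
def meshTriangle (n : ℕ) (t : (ℕ × ℕ) × Bool) : Set (ℝ × ℝ) :=
  bif t.2 then openTriangle n 1 t.1 else openTriangle n (-1) (t.1.1 + 1, t.1.2 + 1)

/-- The indices of the triangles of the mesh. -/
def meshIndex (n : ℕ) : Finset ((ℕ × ℕ) × Bool) :=
  (Finset.range n ×ˢ Finset.range n) ×ˢ Finset.univ

theorem isElement_lower {n : ℕ} {V : ℕ × ℕ} (hV : V ∈ Finset.range n ×ˢ Finset.range n) :
    IsElement n 1 V (V.1 + 1, V.2) (V.1, V.2 + 1) := by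
  simp only [Finset.mem_product, Finset.mem_range] at hV
  constructor <;> (try simp) <;> omega

theorem isElement_upper {n : ℕ} {V : ℕ × ℕ} (hV : V ∈ Finset.range n ×ˢ Finset.range n) :
    IsElement n (-1) (V.1 + 1, V.2 + 1) (V.1, V.2 + 1) (V.1 + 1, V.2) := by
  simp only [Finset.mem_product, Finset.mem_range] at hV
  constructor <;> (try simp) <;> omega

theorem mem_meshTriangle_true {n : ℕ} {V : ℕ × ℕ} {x : ℝ × ℝ} :
    x ∈ meshTriangle n (V, true) ↔ (V.1 : ℝ) < n * x.1 ∧ (V.2 : ℝ) < n * x.2 ∧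
      n * x.1 + n * x.2 < V.1 + V.2 + 1 := by
  simp only [meshTriangle, openTriangle, localCoord, refTriangle, Set.mem_preimage,
    Set.mem_ofPred_eq, cond_true]
  push_cast
  refine ⟨fun ⟨h1, h2, h3⟩ => ⟨?_, ?_, ?_⟩, fun ⟨h1, h2, h3⟩ => ⟨?_, ?_, ?_⟩⟩ <;> linarith

theorem mem_meshTriangle_false {n : ℕ} {V : ℕ × ℕ} {x : ℝ × ℝ} :
    x ∈ meshTriangle n (V, false) ↔ n * x.1 < V.1 + 1 ∧ n * x.2 < V.2 + 1 ∧
      (V.1 : ℝ) + V.2 + 1 < n * x.1 + n * x.2 := by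
  simp only [meshTriangle, openTriangle, localCoord, refTriangle, Set.mem_preimage,
    Set.mem_ofPred_eq, cond_false]
  push_cast
  refine ⟨fun ⟨h1, h2, h3⟩ => ⟨?_, ?_, ?_⟩, fun ⟨h1, h2, h3⟩ => ⟨?_, ?_, ?_⟩⟩ <;> linarith

theorem cell_of_mem_meshTriangle {n : ℕ} {t : (ℕ × ℕ) × Bool} {x : ℝ × ℝ}
    (hx : x ∈ meshTriangle n t) : (t.1.1 : ℝ) < n * x.1 ∧ n * x.1 < t.1.1 + 1 ∧
      (t.1.2 : ℝ) < n * x.2 ∧ n * x.2 < t.1.2 + 1 := by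
  obtain ⟨V, b⟩ := t
  cases b
  · obtain ⟨h1, h2, h3⟩ := mem_meshTriangle_false.1 hx
    simp only
    refine ⟨?_, ?_, ?_, ?_⟩ <;> linarith
  · obtain ⟨h1, h2, h3⟩ := mem_meshTriangle_true.1 hx
    simp only
    refine ⟨?_, ?_, ?_, ?_⟩ <;> linarith

theorem disjoint_meshTriangle {n : ℕ} {t u : (ℕ × ℕ) × Bool} (htu : t ≠ u) :
    Disjoint (meshTriangle n t) (meshTriangle n u) := by
  rw [Set.disjoint_left]
  intro x ht hu
  obtain ⟨a1, a2, a3, a4⟩ := cell_of_mem_meshTriangle ht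
  obtain ⟨b1, b2, b3, b4⟩ := cell_of_mem_meshTriangle hu
  have c1 : t.1.1 < u.1.1 + 1 := by exact_mod_cast a1.trans b2
  have c2 : u.1.1 < t.1.1 + 1 := by exact_mod_cast b1.trans a2
  have c3 : t.1.2 < u.1.2 + 1 := by exact_mod_cast a3.trans b4
  have c4 : u.1.2 < t.1.2 + 1 := by exact_mod_cast b3.trans a4
  obtain ⟨V, b⟩ := t
  obtain ⟨W, b'⟩ := u
  have hVW : V = W := Prod.ext (by simp only at *; omega) (by simp only at *; omega)
  subst hVW
  cases b <;> cases b'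
  · exact htu rfl
  · have := (mem_meshTriangle_false.1 ht).2.2
    have := (mem_meshTriangle_true.1 hu).2.2
    linarith
  · have := (mem_meshTriangle_true.1 ht).2.2
    have := (mem_meshTriangle_false.1 hu).2.2
    linarith
  · exact htu rfl

theorem volume_line_eq_zero {n : ℕ} (hn : n ≠ 0) (k : ℝ) :
    volume {x : ℝ × ℝ | n * x.1 = k} = 0 ∧ volume {x : ℝ × ℝ | n * x.2 = k} = 0 ∧
      volume {x : ℝ × ℝ | n * x.1 + n * x.2 = k} = 0 := by
  have hn' : (n : ℝ) ≠ 0 := by exact_mod_cast hn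
  have hs : ∀ c : ℝ, volume {t : ℝ | n * t = c} = 0 := by
    intro c
    refine measure_mono_null (t := {c / n}) (fun t ht => ?_) Real.volume_singleton
    have ht' : n * t = c := ht
    rw [Set.mem_singleton_iff, ← ht']
    field_simp
  refine ⟨?_, ?_, ?_⟩
  · exact Measure.quasiMeasurePreserving_fst.preimage_null (hs k)
  · exact Measure.quasiMeasurePreserving_snd.preimage_null (hs k)
  · rw [Measure.volume_eq_prod, Measure.measure_prod_null]
    · refine Eventually.of_forall fun s => ?_
      refine measure_mono_null (fun t ht => ?_) (hs (k - n * s))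
      have ht' : n * s + n * t = k := ht
      show n * t = k - n * s
      linarith
    · exact (isClosed_eq (by fun_prop) continuous_const).measurableSet

/-- Off countably many null lines, the integer parts of the scaled coordinates give the cell of a
point, and its side of the diagonal gives the triangle. -/
theorem unitSquare_ae_eq {n : ℕ} (hn : n ≠ 0) :
    unitSquare =ᵐ[volume] ⋃ t ∈ meshIndex n, meshTriangle n t := by
  have hn' : (0 : ℝ) < n := by exact_mod_cast Nat.pos_of_ne_zero hn
  have hsub : (⋃ t ∈ meshIndex n, meshTriangle n t) ⊆ unitSquare := by
    intro x hx
    simp only [Set.mem_iUnion] at hx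
    obtain ⟨⟨V, b⟩, ht, hx⟩ := hx
    have hV := (Finset.mem_product.1 ht).1
    cases b
    · exact openTriangle_subset hn (isElement_upper hV) hx
    · exact openTriangle_subset hn (isElement_lower hV) hx
  have hnull : ∀ᵐ x : ℝ × ℝ, ∀ k : ℕ, n * x.1 ≠ k ∧ n * x.2 ≠ k ∧ n * x.1 + n * x.2 ≠ k := by
    rw [ae_all_iff]
    intro k
    obtain ⟨h1, h2, h3⟩ := volume_line_eq_zero hn (k : ℝ)
    have g1 := measure_eq_zero_iff_ae_notMem.1 h1
    have g2 := measure_eq_zero_iff_ae_notMem.1 h2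
    have g3 := measure_eq_zero_iff_ae_notMem.1 h3
    filter_upwards [g1, g2, g3] with x k1 k2 k3
    exact ⟨k1, k2, k3⟩
  filter_upwards [hnull] with x hx
  refine propext ⟨fun h => ?_, fun h => hsub h⟩
  obtain ⟨⟨a1, a2⟩, a3, a4⟩ : (0 < x.1 ∧ x.1 < 1) ∧ 0 < x.2 ∧ x.2 < 1 := h
  have c0 : (0 : ℝ) ≤ n * x.1 := by positivity
  have d0 : (0 : ℝ) ≤ n * x.2 := by positivity
  have c1 := Nat.floor_le c0
  have c2 := Nat.lt_floor_add_one ((n : ℝ) * x.1)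
  have d1 := Nat.floor_le d0
  have d2 := Nat.lt_floor_add_one ((n : ℝ) * x.2)
  have c3 : ⌊(n : ℝ) * x.1⌋₊ < n := by
    have : ((⌊(n : ℝ) * x.1⌋₊ : ℕ) : ℝ) < n := by nlinarith
    exact_mod_cast this
  have d3 : ⌊(n : ℝ) * x.2⌋₊ < n := by
    have : ((⌊(n : ℝ) * x.2⌋₊ : ℕ) : ℝ) < n := by nlinarith
    exact_mod_cast this
  have e1 := (hx ⌊(n : ℝ) * x.1⌋₊).1
  have e2 := (hx ⌊(n : ℝ) * x.2⌋₊).2.1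
  have e3 := (hx (⌊(n : ℝ) * x.1⌋₊ + ⌊(n : ℝ) * x.2⌋₊ + 1)).2.2
  push_cast at e3
  have hmem : ∀ b : Bool, ((⌊(n : ℝ) * x.1⌋₊, ⌊(n : ℝ) * x.2⌋₊), b) ∈ meshIndex n := by
    intro b
    simp [meshIndex, c3, d3]
  refine Set.mem_iUnion₂.2 ?_
  rcases lt_or_gt_of_ne e3 with h | h
  · exact ⟨_, hmem true, mem_meshTriangle_true.2
      ⟨lt_of_le_of_ne c1 e1.symm, lt_of_le_of_ne d1 e2.symm, h⟩⟩
  · exact ⟨_, hmem false, mem_meshTriangle_false.2 ⟨c2, d2, h⟩⟩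

/-- The assembly of the stiffness matrix from the stiffness matrix of the reference triangle. -/
theorem stiffness_apply {n : ℕ} (p q : NodeIndex n) :
    stiffness (fun _ => 1) n p q = ∑ V ∈ Finset.range n ×ˢ Finset.range n,
      (refStiffness (localNode 1 V p) (localNode 1 V q) +
        refStiffness (localNode (-1) (V.1 + 1, V.2 + 1) p)
          (localNode (-1) (V.1 + 1, V.2 + 1) q)) := by
  have hn : n ≠ 0 := by
    have := p.1.2
    omega
  simp only [stiffness, Matrix.of_apply, one_mul]
  have hint : ∀ t ∈ meshIndex n,
      IntegrableOn (gradDot (cubicBasis n q) (cubicBasis n p)) (meshTriangle n t) := by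
    rintro ⟨V, b⟩ ht
    have hV := (Finset.mem_product.1 ht).1
    cases b
    · exact integrableOn_gradDot_cubicBasis hn (isElement_upper hV) p q
    · exact integrableOn_gradDot_cubicBasis hn (isElement_lower hV) p q
  have hmeas : ∀ t ∈ meshIndex n, MeasurableSet (meshTriangle n t) := by
    rintro ⟨V, b⟩ _
    cases b <;> exact isOpen_openTriangle.measurableSet
  rw [setIntegral_congr_set (unitSquare_ae_eq hn),
    integral_biUnion_finset _ hmeas (fun t _ u _ htu => disjoint_meshTriangle htu) hint,
    meshIndex, Finset.sum_product]
  refine Finset.sum_congr rfl fun V hV => ?_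
  rw [Fintype.sum_bool]
  exact congrArg₂ _ (integral_gradDot_cubicBasis hn (isElement_lower hV) p q)
    (integral_gradDot_cubicBasis hn (isElement_upper hV) p q)

/-! ### The stiffness matrix of the reference triangle -/

/-- The exponents of the monomials of degree at most `3` in two variables; these are also the nodes
of the reference triangle, multiplied by `3`. -/
def cubicIndex : Fin 10 → ℕ × ℕ :=
  ![(0, 0), (1, 0), (0, 1), (2, 0), (1, 1), (0, 2), (3, 0), (2, 1), (1, 2), (0, 3)]

/-- Twice the coefficients of the cubic shape functions. -/
def shapeCoeff : Matrix (Fin 10) (Fin 10) ℤ :=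
  !![2, -11, -11, 18, 36, 18, -9, -27, -27, -9;
    0, 18, 0, -45, -45, 0, 27, 54, 27, 0;
    0, 0, 18, 0, -45, -45, 0, 27, 54, 27;
    0, -9, 0, 36, 9, 0, -27, -27, 0, 0;
    0, 0, 0, 0, 54, 0, 0, -54, -54, 0;
    0, 0, -9, 0, 9, 36, 0, 0, -27, -27;
    0, 2, 0, -9, 0, 0, 9, 0, 0, 0;
    0, 0, 0, 0, -9, 0, 0, 27, 0, 0;
    0, 0, 0, 0, -9, 0, 0, 0, 27, 0;
    0, 0, 2, 0, 0, -9, 0, 0, 0, 9]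

/-- The stiffness matrix of the reference triangle, multiplied by `160`. -/
def refTable : Matrix (Fin 10) (Fin 10) ℤ :=
  !![136, -102, -102, 60, 0, 60, -14, -12, -12, -14;
    -102, 540, 0, -270, -324, 0, 54, 54, 54, -6;
    -102, 0, 540, 0, -324, -270, -6, 54, 54, 54;
    60, -270, 0, 540, 0, 0, -108, -270, 54, -6;
    0, -324, -324, 0, 1296, 0, 0, -324, -324, 0;
    60, 0, -270, 0, 0, 540, -6, 54, -270, -108;
    -14, 54, -6, -108, 0, -6, 68, 6, 6, 0;
    -12, 54, 54, -270, -324, 54, 6, 540, -108, 6;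
    -12, 54, 54, 54, -324, -270, 6, -108, 540, 6;
    -14, -6, 54, -6, 0, -108, 0, 6, 6, 68]

/-- The integral of a monomial over the reference triangle, multiplied by `720`. This is an integer
up to degree `4`. -/
def monomialIntegral (a b : ℕ) : ℤ :=
  ((720 * (a.factorial * b.factorial) / (a + b + 2).factorial : ℕ) : ℤ)

/-- The contribution of two monomials to the stiffness matrix of the reference triangle, multiplied
by `720`. -/
def monomialStiffness (i j : ℕ × ℕ) : ℤ :=
  i.1 * j.1 * monomialIntegral (i.1 - 1 + (j.1 - 1)) (i.2 + j.2) +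
    i.2 * j.2 * monomialIntegral (i.1 + j.1) (i.2 - 1 + (j.2 - 1))

/-- The shape coefficients carry denominators `2` and the monomial integrals `720`; the factor is
`18 = 4 · 720 / 160`. -/
theorem refTable_eq : ∀ k l : Fin 10, 18 * refTable k l = ∑ m : Fin 10, ∑ m' : Fin 10,
    shapeCoeff l m * shapeCoeff k m' * monomialStiffness (cubicIndex m) (cubicIndex m') := by
  decide +kernel

/-- The index of a node of the reference triangle. -/
def nodeNumber (p : ℤ × ℤ) : Option (Fin 10) :=
  (List.finRange 10).find? fun k => ((cubicIndex k).1 : ℤ) = p.1 ∧ ((cubicIndex k).2 : ℤ) = p.2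

/-- The entries of the stiffness matrix of the reference triangle, multiplied by `160`. -/
def refEntry (p q : ℤ × ℤ) : ℤ :=
  match nodeNumber p, nodeNumber q with
  | some k, some l => refTable k l
  | _, _ => 0

/-- The position, multiplied by `3`, of a node of a given type in its cell. -/
def nodeType (s : Fin 9) : ℤ × ℤ := ((s.1 % 3 : ℕ) + 1, (s.1 / 3 : ℕ) + 1)

/-- The contributions of the two triangles of a cell to an entry of the stiffness matrix, multiplied
by `160`. -/
def cellEntry (p q d : ℤ × ℤ) : ℤ :=
  refEntry (p - 3 * d) (q - 3 * d) + refEntry (3 + 3 * d - p) (3 + 3 * d - q)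

/-- The second node has position `nodeType t - 3 * k` relative to the cell of the first, where `k`
is the difference of the cells. Four cells occur because the first node may lie on the right or
upper edge of its own. The factor `2` passes from denominator `160` to `80`. -/
theorem symbolTable_eq_sum_cellEntry : ∀ k ∈ neighbours, ∀ s t : Fin 9,
    cellEntry (nodeType s) (nodeType t - 3 * k) (0, 0) +
      cellEntry (nodeType s) (nodeType t - 3 * k) (0, 1) +
      (cellEntry (nodeType s) (nodeType t - 3 * k) (1, 0) +
      cellEntry (nodeType s) (nodeType t - 3 * k) (1, 1)) = 2 * symbolTable k s t := by
  decide +kernel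

/-- The Beta integral. Splitting off one factor `1 - x` lowers `b` at the cost of raising `a`, hence
the induction with `a` free. -/
theorem integral_pow_mul_one_sub_pow (a b : ℕ) :
    ∫ x in (0 : ℝ)..1, x ^ a * (1 - x) ^ b =
      (a.factorial * b.factorial : ℝ) / (a + b + 1).factorial := by
  induction b generalizing a with
  | zero =>
    simp only [pow_zero, mul_one, integral_pow, one_pow, Nat.factorial_zero, Nat.cast_one, add_zero,
      Nat.factorial_succ]
    have := Nat.factorial_ne_zero a
    push_cast
    field_simp
    simp
  | succ b ih =>
    have e : ∀ x : ℝ, x ^ a * (1 - x) ^ (b + 1) = x ^ a * (1 - x) ^ b - x ^ (a + 1) * (1 - x) ^ b :=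
      fun x => by ring
    simp only [e]
    rw [intervalIntegral.integral_sub (Continuous.intervalIntegrable (by fun_prop) _ _)
      (Continuous.intervalIntegrable (by fun_prop) _ _), ih, ih]
    have e1 : a + 1 + b + 1 = a + b + 1 + 1 := by ring
    have e2 : a + (b + 1) + 1 = a + b + 1 + 1 := by ring
    rw [e1, e2, Nat.factorial_succ (a + b + 1), Nat.factorial_succ a, Nat.factorial_succ b]
    have h1 : ((a + b + 1).factorial : ℝ) ≠ 0 := by exact_mod_cast Nat.factorial_ne_zero _
    push_cast
    field_simp
    ring

theorem integrableOn_refTriangle {g : ℝ × ℝ → ℝ} (hg : Continuous g) :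
    IntegrableOn g refTriangle := by
  refine (hg.continuousOn.integrableOn_compact
    (K := Set.Icc (0 : ℝ) 1 ×ˢ Set.Icc (0 : ℝ) 1) (isCompact_Icc.prod isCompact_Icc)).mono_set ?_
  rintro y ⟨h1, h2, h3⟩
  exact ⟨⟨h1.le, by linarith⟩, ⟨h2.le, by linarith⟩⟩

/-- By Fubini, the inner integral over `(0, 1 - x)` leaves a Beta integral with exponents `a` and `b
+ 1`. -/
theorem integral_monomial (a b : ℕ) :
    ∫ y in refTriangle, y.1 ^ a * y.2 ^ b =
      (a.factorial * b.factorial : ℝ) / (a + b + 2).factorial := by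
  have hc : Continuous fun y : ℝ × ℝ => y.1 ^ a * y.2 ^ b := by fun_prop
  have hi := (integrable_indicator_iff isOpen_refTriangle.measurableSet).2
    (integrableOn_refTriangle hc)
  rw [← integral_indicator isOpen_refTriangle.measurableSet]
  rw [Measure.volume_eq_prod] at hi ⊢
  rw [integral_prod _ hi]
  have e : ∀ x : ℝ, ∫ t, refTriangle.indicator (fun y : ℝ × ℝ => y.1 ^ a * y.2 ^ b) (x, t) =
      (Set.Ioo (0 : ℝ) 1).indicator (fun x => x ^ a * (1 - x) ^ (b + 1) / (b + 1)) x := by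
    intro x
    by_cases hx : x ∈ Set.Ioo (0 : ℝ) 1
    · rw [Set.indicator_of_mem hx]
      have e1 : (fun t => refTriangle.indicator (fun y : ℝ × ℝ => y.1 ^ a * y.2 ^ b) (x, t)) =
          (Set.Ioo (0 : ℝ) (1 - x)).indicator fun t => x ^ a * t ^ b := by
        ext t
        have : (x, t) ∈ refTriangle ↔ t ∈ Set.Ioo (0 : ℝ) (1 - x) := by
          simp only [refTriangle, Set.mem_ofPred_eq, Set.mem_Ioo]
          constructor
          · rintro ⟨h1, h2, h3⟩
            exact ⟨h2, by linarith⟩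
          · rintro ⟨h2, h3⟩
            exact ⟨hx.1, h2, by linarith⟩
        by_cases ht : t ∈ Set.Ioo (0 : ℝ) (1 - x)
        · rw [Set.indicator_of_mem ht, Set.indicator_of_mem (this.2 ht)]
        · rw [Set.indicator_of_notMem ht, Set.indicator_of_notMem (mt this.1 ht)]
      rw [e1, integral_indicator measurableSet_Ioo, integral_const_mul,
        ← integral_Ioc_eq_integral_Ioo,
        ← intervalIntegral.integral_of_le (by linarith [hx.2]), integral_pow]
      simp
      ring
    · rw [Set.indicator_of_notMem hx]
      have e1 : (fun t => refTriangle.indicator (fun y : ℝ × ℝ => y.1 ^ a * y.2 ^ b) (x, t)) =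
          fun _ => 0 := by
        ext t
        refine Set.indicator_of_notMem (fun h => hx ?_) _
        obtain ⟨h1, h2, h3⟩ := h
        simp only at h1 h2 h3
        exact ⟨h1, by linarith⟩
      rw [e1, integral_zero]
  simp only [e]
  rw [integral_indicator measurableSet_Ioo, ← integral_Ioc_eq_integral_Ioo,
    ← intervalIntegral.integral_of_le zero_le_one, intervalIntegral.integral_div,
    integral_pow_mul_one_sub_pow, Nat.factorial_succ b]
  push_cast
  have : (b : ℝ) + 1 ≠ 0 := by positivity
  field_simp
  rfl

theorem integral_monomial_eq {a b : ℕ} (h : a + b ≤ 4) :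
    ∫ y in refTriangle, y.1 ^ a * y.2 ^ b = (monomialIntegral a b : ℝ) / 720 := by
  rw [integral_monomial]
  have ha : a ≤ 4 := by omega
  have hb : b ≤ 4 := by omega
  -- The division in `monomialIntegral` is exact because `(a + b + 2)!` divides `6! = 720`.
  have key : 720 * (a.factorial * b.factorial) =
      (720 * (a.factorial * b.factorial) / (a + b + 2).factorial) * (a + b + 2).factorial := by
    interval_cases a <;> interval_cases b <;> first | decide | omega
  have key' : (720 * (a.factorial * b.factorial) : ℝ) =
      (monomialIntegral a b : ℝ) * (a + b + 2).factorial := by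
    unfold monomialIntegral
    rw [Int.cast_natCast]
    exact_mod_cast key
  have h1 : ((a + b + 2).factorial : ℝ) ≠ 0 := by exact_mod_cast Nat.factorial_ne_zero _
  rw [div_eq_div_iff h1 (by norm_num)]
  linarith

/-- The monomial with the given exponents. -/
def monomialFun (i : ℕ × ℕ) (y : ℝ × ℝ) : ℝ := y.1 ^ i.1 * y.2 ^ i.2

theorem hasFDerivAt_monomialFun (i : ℕ × ℕ) (y : ℝ × ℝ) :
    HasFDerivAt (monomialFun i)
      ((i.1 * y.1 ^ (i.1 - 1) * y.2 ^ i.2) • ContinuousLinearMap.fst ℝ ℝ ℝ +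
        (i.2 * y.1 ^ i.1 * y.2 ^ (i.2 - 1)) • ContinuousLinearMap.snd ℝ ℝ ℝ) y := by
  have h := ((hasFDerivAt_fst (𝕜 := ℝ) (p := y)).pow i.1).mul
    ((hasFDerivAt_snd (𝕜 := ℝ) (p := y)).pow i.2)
  refine h.congr_fderiv ?_
  ext <;> simp <;> ring

theorem gradDot_sum_monomialFun {ι : Type*} (s : Finset ι) (e : ι → ℕ × ℕ) (a b : ι → ℝ)
    (y : ℝ × ℝ) :
    gradDot (fun y => ∑ m ∈ s, a m * monomialFun (e m) y)
      (fun y => ∑ m ∈ s, b m * monomialFun (e m) y) y =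
      ∑ m ∈ s, ∑ m' ∈ s, a m * b m' *
        ((e m).1 * (e m').1 * (y.1 ^ ((e m).1 - 1 + ((e m').1 - 1)) * y.2 ^ ((e m).2 + (e m').2)) +
        (e m).2 * (e m').2 *
          (y.1 ^ ((e m).1 + (e m').1) * y.2 ^ ((e m).2 - 1 + ((e m').2 - 1)))) := by
  have h : ∀ a : ι → ℝ, HasFDerivAt (fun y => ∑ m ∈ s, a m * monomialFun (e m) y)
      (∑ m ∈ s, a m • (((e m).1 * y.1 ^ ((e m).1 - 1) * y.2 ^ (e m).2) •
        ContinuousLinearMap.fst ℝ ℝ ℝ +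
        ((e m).2 * y.1 ^ (e m).1 * y.2 ^ ((e m).2 - 1)) • ContinuousLinearMap.snd ℝ ℝ ℝ)) y :=
    fun a => HasFDerivAt.fun_sum fun m _ => (hasFDerivAt_monomialFun (e m) y).const_mul (a m)
  unfold gradDot
  rw [(h a).fderiv, (h b).fderiv]
  simp only [sum_apply, smul_apply,
    add_apply, ContinuousLinearMap.coe_fst', ContinuousLinearMap.coe_snd',
    smul_eq_mul, mul_one, mul_zero, add_zero, zero_add]
  rw [Finset.sum_mul_sum, Finset.sum_mul_sum, ← Finset.sum_add_distrib]
  refine Finset.sum_congr rfl fun m _ => ?_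
  rw [← Finset.sum_add_distrib]
  refine Finset.sum_congr rfl fun m' _ => ?_
  rw [pow_add, pow_add, pow_add, pow_add]
  ring

theorem integral_monomialStiffness {i j : ℕ × ℕ} (hi : i.1 + i.2 ≤ 3) (hj : j.1 + j.2 ≤ 3) :
    ∫ y in refTriangle, ((i.1 : ℝ) * j.1 * (y.1 ^ (i.1 - 1 + (j.1 - 1)) * y.2 ^ (i.2 + j.2)) +
        i.2 * j.2 * (y.1 ^ (i.1 + j.1) * y.2 ^ (i.2 - 1 + (j.2 - 1)))) =
      (monomialStiffness i j : ℝ) / 720 := by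
  rw [integral_add (integrableOn_refTriangle (by fun_prop)) (integrableOn_refTriangle (by fun_prop)),
    integral_const_mul, integral_const_mul]
  have h1 : (i.1 : ℝ) * j.1 * ∫ y in refTriangle, y.1 ^ (i.1 - 1 + (j.1 - 1)) * y.2 ^ (i.2 + j.2) =
      i.1 * j.1 * ((monomialIntegral (i.1 - 1 + (j.1 - 1)) (i.2 + j.2) : ℝ) / 720) := by
    -- For a zero exponent the truncated subtraction gives a wrong monomial, possibly of degree `5`,
    -- but the coefficient vanishes. Otherwise the degree is at most `4`.
    by_cases hi0 : i.1 = 0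
    · simp [hi0]
    by_cases hj0 : j.1 = 0
    · simp [hj0]
    rw [integral_monomial_eq (by omega)]
  have h2 : (i.2 : ℝ) * j.2 * ∫ y in refTriangle, y.1 ^ (i.1 + j.1) * y.2 ^ (i.2 - 1 + (j.2 - 1)) =
      i.2 * j.2 * ((monomialIntegral (i.1 + j.1) (i.2 - 1 + (j.2 - 1)) : ℝ) / 720) := by
    by_cases hi0 : i.2 = 0
    · simp [hi0]
    by_cases hj0 : j.2 = 0
    · simp [hj0]
    rw [integral_monomial_eq (by omega)]
  rw [h1, h2]
  unfold monomialStiffness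
  push_cast
  ring

theorem shape_cubicIndex (k : Fin 10) :
    shape ((cubicIndex k).1, (cubicIndex k).2) =
      fun y => ∑ m : Fin 10, (shapeCoeff k m : ℝ) / 2 * monomialFun (cubicIndex m) y := by
  ext y
  unfold shape
  fin_cases k <;>
    simp [cubicIndex, shapeCoeff, monomialFun, lagrangeFactor, Fin.sum_univ_succ,
      Finset.prod_range_succ] <;> ring

theorem refStiffness_cubicIndex (k l : Fin 10) :
    refStiffness ((cubicIndex k).1, (cubicIndex k).2) ((cubicIndex l).1, (cubicIndex l).2) =
      (refTable k l : ℝ) / 160 := by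
  unfold refStiffness
  rw [shape_cubicIndex, shape_cubicIndex]
  simp only [gradDot_sum_monomialFun]
  have hdeg : ∀ m, (cubicIndex m).1 + (cubicIndex m).2 ≤ 3 := by decide
  rw [integral_finsetSum]
  swap
  · intro m _
    exact integrableOn_refTriangle (by fun_prop)
  have h1 : ∀ m, ∫ y in refTriangle, (∑ m' : Fin 10,
      (shapeCoeff l m : ℝ) / 2 * ((shapeCoeff k m' : ℝ) / 2) *
        (((cubicIndex m).1 : ℝ) * (cubicIndex m').1 *
          (y.1 ^ ((cubicIndex m).1 - 1 + ((cubicIndex m').1 - 1)) *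
            y.2 ^ ((cubicIndex m).2 + (cubicIndex m').2)) +
        (cubicIndex m).2 * (cubicIndex m').2 * (y.1 ^ ((cubicIndex m).1 + (cubicIndex m').1) *
          y.2 ^ ((cubicIndex m).2 - 1 + ((cubicIndex m').2 - 1))))) =
      ∑ m' : Fin 10, (shapeCoeff l m : ℝ) / 2 * ((shapeCoeff k m' : ℝ) / 2) *
        ((monomialStiffness (cubicIndex m) (cubicIndex m') : ℝ) / 720) := by
    intro m
    rw [integral_finsetSum]
    · refine Finset.sum_congr rfl fun m' _ => ?_
      rw [integral_const_mul, integral_monomialStiffness (hdeg m) (hdeg m')]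
    · intro m' _
      exact integrableOn_refTriangle (by fun_prop)
  rw [Finset.sum_congr rfl fun m _ => h1 m]
  have h2 : (18 * refTable k l : ℝ) = ∑ m : Fin 10, ∑ m' : Fin 10,
      (shapeCoeff l m : ℝ) * shapeCoeff k m' *
        monomialStiffness (cubicIndex m) (cubicIndex m') := by
    exact_mod_cast refTable_eq k l
  have h3 : (refTable k l : ℝ) / 160 = (18 * refTable k l : ℝ) / 2880 := by ring
  rw [h3, h2, Finset.sum_div]
  refine Finset.sum_congr rfl fun m _ => ?_
  rw [Finset.sum_div]
  refine Finset.sum_congr rfl fun m' _ => ?_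
  ring

theorem shape_eq_zero {p : ℤ × ℤ} (hp : ¬(0 ≤ p.1 ∧ 0 ≤ p.2 ∧ p.1 + p.2 ≤ 3)) :
    shape p = fun _ => 0 := by
  ext y
  exact if_neg hp

theorem nodeNumber_eq_none {p : ℤ × ℤ} (hp : nodeNumber p = none) :
    ¬(0 ≤ p.1 ∧ 0 ≤ p.2 ∧ p.1 + p.2 ≤ 3) := by
  rintro ⟨h1, h2, h3⟩
  obtain ⟨a, b⟩ := p
  simp only at h1 h2 h3
  have ha : a ≤ 3 := by omega
  have hb : b ≤ 3 := by omega
  revert hp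
  interval_cases a <;> interval_cases b <;> first | decide | omega

theorem nodeNumber_eq_some {p : ℤ × ℤ} {k : Fin 10} (hp : nodeNumber p = some k) :
    p = (((cubicIndex k).1 : ℤ), ((cubicIndex k).2 : ℤ)) := by
  have := List.find?_some hp
  simp only [decide_eq_true_eq] at this
  exact Prod.ext this.1.symm this.2.symm

/-- Pairs that are not nodes of the reference triangle give zero on both sides, so the assembly
needs no case distinction. -/
theorem refStiffness_eq (p q : ℤ × ℤ) : refStiffness p q = (refEntry p q : ℝ) / 160 := by
  unfold refEntry
  rcases hp : nodeNumber p with _ | k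
  · simp [refStiffness, shape_eq_zero (nodeNumber_eq_none hp), gradDot]
  rcases hq : nodeNumber q with _ | l
  · simp [refStiffness, shape_eq_zero (nodeNumber_eq_none hq), gradDot]
  rw [nodeNumber_eq_some hp, nodeNumber_eq_some hq]
  exact refStiffness_cubicIndex k l

theorem refEntry_eq_zero_left {p q : ℤ × ℤ} (hp : ¬(0 ≤ p.1 ∧ 0 ≤ p.2 ∧ p.1 + p.2 ≤ 3)) :
    refEntry p q = 0 := by
  have := refStiffness_eq p q
  rw [refStiffness, shape_eq_zero hp] at this
  have h0 : (refEntry p q : ℝ) = 0 := by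
    simp [gradDot] at this
    linarith
  exact_mod_cast h0

theorem refEntry_eq_zero_right {p q : ℤ × ℤ} (hq : ¬(0 ≤ q.1 ∧ 0 ≤ q.2 ∧ q.1 + q.2 ≤ 3)) :
    refEntry p q = 0 := by
  have := refStiffness_eq p q
  rw [refStiffness, shape_eq_zero hq] at this
  have h0 : (refEntry p q : ℝ) = 0 := by
    simp [gradDot] at this
    linarith
  exact_mod_cast h0

/-! ### The stiffness matrix as a section of a block Laurent operator -/

/-- The cell of a node, which lies above and to the right of the left and lower edges of it. -/
def nodeCell {n : ℕ} (p : NodeIndex n) : ℤ × ℤ := (((p.1 : ℕ) / 3 : ℕ), ((p.2 : ℕ) / 3 : ℕ))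

/-- The type of a node: the index of its position in its cell. -/
def nodeKind {n : ℕ} (p : NodeIndex n) : Fin 9 :=
  ⟨(p.1 : ℕ) % 3 + 3 * ((p.2 : ℕ) % 3), by omega⟩

/-- Positions run over `1, 2, 3` rather than `0, 1, 2`, so a node on a grid line belongs to the cell
to the left of it or below it. In particular (cell, type) determines the node. -/
theorem nodeType_nodeKind {n : ℕ} (p : NodeIndex n) :
    nodeType (nodeKind p) + 3 * nodeCell p = (((p.1 : ℕ) : ℤ) + 1, ((p.2 : ℕ) : ℤ) + 1) := by
  refine Prod.ext ?_ ?_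
  · show ((((p.1 : ℕ) % 3 + 3 * ((p.2 : ℕ) % 3)) % 3 : ℕ) : ℤ) + 1 + 3 * (((p.1 : ℕ) / 3 : ℕ) : ℤ) =
      ((p.1 : ℕ) : ℤ) + 1
    omega
  · show ((((p.1 : ℕ) % 3 + 3 * ((p.2 : ℕ) % 3)) / 3 : ℕ) : ℤ) + 1 + 3 * (((p.2 : ℕ) / 3 : ℕ) : ℤ) =
      ((p.2 : ℕ) : ℤ) + 1
    omega

theorem nodeType_mem (s : Fin 9) : 1 ≤ (nodeType s).1 ∧ (nodeType s).1 ≤ 3 ∧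
    1 ≤ (nodeType s).2 ∧ (nodeType s).2 ≤ 3 := by
  revert s; decide

theorem cellEntry_eq_zero_of_position (s : Fin 9) (q : ℤ × ℤ) {d : ℤ × ℤ}
    (hd : ¬((d.1 = 0 ∨ d.1 = 1) ∧ (d.2 = 0 ∨ d.2 = 1))) : cellEntry (nodeType s) q d = 0 := by
  have h := nodeType_mem s
  unfold cellEntry
  rw [refEntry_eq_zero_left, refEntry_eq_zero_left, add_zero]
  · show ¬(0 ≤ 3 + 3 * d.1 - (nodeType s).1 ∧ 0 ≤ 3 + 3 * d.2 - (nodeType s).2 ∧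
      3 + 3 * d.1 - (nodeType s).1 + (3 + 3 * d.2 - (nodeType s).2) ≤ 3)
    omega
  · show ¬(0 ≤ (nodeType s).1 - 3 * d.1 ∧ 0 ≤ (nodeType s).2 - 3 * d.2 ∧
      (nodeType s).1 - 3 * d.1 + ((nodeType s).2 - 3 * d.2) ≤ 3)
    omega

theorem refEntry_eq_zero_of_far {p q : ℤ × ℤ}
    (h : ¬(|p.1 - q.1| ≤ 3 ∧ |p.2 - q.2| ≤ 3)) : refEntry p q = 0 := by
  simp only [abs_le] at h
  by_cases hp : 0 ≤ p.1 ∧ 0 ≤ p.2 ∧ p.1 + p.2 ≤ 3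
  · refine refEntry_eq_zero_right fun hq => h ?_
    omega
  · exact refEntry_eq_zero_left hp

/-- Two nodes of one triangle differ by at most `3` in each scaled coordinate, while cells that are
not neighbours put a coordinate difference of at least `4` between their nodes. -/
theorem cellEntry_eq_zero_of_far (s t : Fin 9) {k : ℤ × ℤ} (hk : k ∉ neighbours) (d : ℤ × ℤ) :
    cellEntry (nodeType s) (nodeType t - 3 * k) d = 0 := by
  have hs := nodeType_mem s
  have ht := nodeType_mem t
  simp only [mem_neighbours, abs_le] at hk
  unfold cellEntry
  rw [refEntry_eq_zero_of_far, refEntry_eq_zero_of_far, add_zero]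
  · show ¬(|3 + 3 * d.1 - (nodeType s).1 - (3 + 3 * d.1 - ((nodeType t).1 - 3 * k.1))| ≤ 3 ∧
      |3 + 3 * d.2 - (nodeType s).2 - (3 + 3 * d.2 - ((nodeType t).2 - 3 * k.2))| ≤ 3)
    simp only [abs_le]
    omega
  · show ¬(|(nodeType s).1 - 3 * d.1 - ((nodeType t).1 - 3 * k.1 - 3 * d.1)| ≤ 3 ∧
      |(nodeType s).2 - 3 * d.2 - ((nodeType t).2 - 3 * k.2 - 3 * d.2)| ≤ 3)
    simp only [abs_le]
    omega

theorem sum_cellEntry (k : ℤ × ℤ) (s t : Fin 9) :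
    cellEntry (nodeType s) (nodeType t - 3 * k) (0, 0) +
      cellEntry (nodeType s) (nodeType t - 3 * k) (0, 1) +
      (cellEntry (nodeType s) (nodeType t - 3 * k) (1, 0) +
      cellEntry (nodeType s) (nodeType t - 3 * k) (1, 1)) = 2 * symbolTable k s t := by
  by_cases hk : k ∈ neighbours
  · exact symbolTable_eq_sum_cellEntry k hk s t
  · simp [cellEntry_eq_zero_of_far s t hk, symbolTable_eq_zero hk]

/-- This is where the boundary turns out to be harmless. A cell beyond the last one could only
contain `p` if `p` had a coordinate `3n`, which internal nodes do not have, so its contribution is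
zero. -/
theorem sum_range_cellEntry {n : ℕ} (p : NodeIndex n) (q : ℤ × ℤ) :
    ∑ V ∈ Finset.range n ×ˢ Finset.range n,
        cellEntry (nodeType (nodeKind p)) q (((V.1 : ℤ), (V.2 : ℤ)) - nodeCell p) =
      cellEntry (nodeType (nodeKind p)) q (0, 0) + cellEntry (nodeType (nodeKind p)) q (0, 1) +
      (cellEntry (nodeType (nodeKind p)) q (1, 0) + cellEntry (nodeType (nodeKind p)) q (1, 1)) := by
  have h1 := p.1.2
  have h2 := p.2.2
  set C₁ : ℕ := (p.1 : ℕ) / 3 with hC₁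
  set C₂ : ℕ := (p.2 : ℕ) / 3 with hC₂
  have hcell : nodeCell p = ((C₁ : ℤ), (C₂ : ℤ)) := rfl
  have hkind : nodeType (nodeKind p) =
      ((((p.1 : ℕ) % 3 : ℕ) : ℤ) + 1, (((p.2 : ℕ) % 3 : ℕ) : ℤ) + 1) := by
    have := nodeType_nodeKind p
    rw [hcell] at this
    have e1 : (nodeType (nodeKind p)).1 + 3 * (C₁ : ℤ) = ((p.1 : ℕ) : ℤ) + 1 :=
      congrArg Prod.fst this
    have e2 : (nodeType (nodeKind p)).2 + 3 * (C₂ : ℤ) = ((p.2 : ℕ) : ℤ) + 1 :=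
      congrArg Prod.snd this
    refine Prod.ext ?_ ?_ <;> simp only <;> omega
  have key : ∑ V ∈ Finset.range n ×ˢ Finset.range n,
        cellEntry (nodeType (nodeKind p)) q (((V.1 : ℤ), (V.2 : ℤ)) - nodeCell p) =
      ∑ V ∈ ({C₁, C₁ + 1} : Finset ℕ) ×ˢ ({C₂, C₂ + 1} : Finset ℕ),
        cellEntry (nodeType (nodeKind p)) q (((V.1 : ℤ), (V.2 : ℤ)) - nodeCell p) := by
    refine Finset.sum_congr_of_eq_on_inter (fun V _ hV => ?_) (fun V hV hVr => ?_) fun _ _ _ => rfl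
    · refine cellEntry_eq_zero_of_position _ _ fun h => hV ?_
      have h' : ((V.1 : ℤ) - C₁ = 0 ∨ (V.1 : ℤ) - C₁ = 1) ∧
        ((V.2 : ℤ) - C₂ = 0 ∨ (V.2 : ℤ) - C₂ = 1) := h
      simp only [Finset.mem_product, Finset.mem_insert, Finset.mem_singleton]
      omega
    · simp only [Finset.mem_product, Finset.mem_insert, Finset.mem_singleton,
        Finset.mem_range] at hV hVr
      rw [hkind, hcell]
      unfold cellEntry
      rw [refEntry_eq_zero_left, refEntry_eq_zero_left, add_zero]
      · show ¬(0 ≤ 3 + 3 * ((V.1 : ℤ) - C₁) - ((((p.1 : ℕ) % 3 : ℕ) : ℤ) + 1) ∧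
          0 ≤ 3 + 3 * ((V.2 : ℤ) - C₂) - ((((p.2 : ℕ) % 3 : ℕ) : ℤ) + 1) ∧
          3 + 3 * ((V.1 : ℤ) - C₁) - ((((p.1 : ℕ) % 3 : ℕ) : ℤ) + 1) +
            (3 + 3 * ((V.2 : ℤ) - C₂) - ((((p.2 : ℕ) % 3 : ℕ) : ℤ) + 1)) ≤ 3)
        omega
      · show ¬(0 ≤ (((p.1 : ℕ) % 3 : ℕ) : ℤ) + 1 - 3 * ((V.1 : ℤ) - C₁) ∧
          0 ≤ (((p.2 : ℕ) % 3 : ℕ) : ℤ) + 1 - 3 * ((V.2 : ℤ) - C₂) ∧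
          (((p.1 : ℕ) % 3 : ℕ) : ℤ) + 1 - 3 * ((V.1 : ℤ) - C₁) +
            ((((p.2 : ℕ) % 3 : ℕ) : ℤ) + 1 - 3 * ((V.2 : ℤ) - C₂)) ≤ 3)
        omega
  rw [key, Finset.sum_product, Finset.sum_pair (Nat.succ_ne_self _).symm,
    Finset.sum_pair (Nat.succ_ne_self _).symm, Finset.sum_pair (Nat.succ_ne_self _).symm, hcell]
  simp
  rfl

/-- The entries of the stiffness matrix are Fourier coefficients of the symbol. -/
theorem stiffness_eq_symbolTable {n : ℕ} (p q : NodeIndex n) : stiffness (fun _ => 1) n p q =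
    (symbolTable (nodeCell p - nodeCell q) (nodeKind p) (nodeKind q) : ℝ) / 80 := by
  rw [stiffness_apply]
  have hp := nodeType_nodeKind p
  have hq := nodeType_nodeKind q
  have hterm : ∀ V : ℕ × ℕ, refStiffness (localNode 1 V p) (localNode 1 V q) +
      refStiffness (localNode (-1) (V.1 + 1, V.2 + 1) p) (localNode (-1) (V.1 + 1, V.2 + 1) q) =
      (cellEntry (nodeType (nodeKind p))
        (nodeType (nodeKind q) - 3 * (nodeCell p - nodeCell q))
        (((V.1 : ℤ), (V.2 : ℤ)) - nodeCell p) : ℝ) / 160 := by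
    intro V
    have l1 : ∀ r : NodeIndex n, localNode 1 V r =
        (((r.1 : ℕ) : ℤ) + 1, ((r.2 : ℕ) : ℤ) + 1) - 3 * ((V.1 : ℤ), (V.2 : ℤ)) := by
      intro r
      refine Prod.ext ?_ ?_
      · exact one_mul _
      · exact one_mul _
    -- The upper triangle of a cell is the point reflection of the lower one, which matches the
    -- second term of `cellEntry`.
    have l2 : ∀ r : NodeIndex n, localNode (-1) (V.1 + 1, V.2 + 1) r =
        3 + 3 * ((V.1 : ℤ), (V.2 : ℤ)) - (((r.1 : ℕ) : ℤ) + 1, ((r.2 : ℕ) : ℤ) + 1) := by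
      intro r
      refine Prod.ext ?_ ?_
      · show -1 * (((r.1 : ℕ) : ℤ) + 1 - 3 * ((V.1 + 1 : ℕ) : ℤ)) =
          3 + 3 * (V.1 : ℤ) - (((r.1 : ℕ) : ℤ) + 1)
        push_cast; ring
      · show -1 * (((r.2 : ℕ) : ℤ) + 1 - 3 * ((V.2 + 1 : ℕ) : ℤ)) =
          3 + 3 * (V.2 : ℤ) - (((r.2 : ℕ) : ℤ) + 1)
        push_cast; ring
    rw [refStiffness_eq, refStiffness_eq, l1, l1, l2, l2, ← hp, ← hq]
    unfold cellEntry
    push_cast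
    rw [add_div]
    congr 4 <;> ring_nf
  simp only [hterm]
  rw [← Finset.sum_div, ← Int.cast_sum, sum_range_cellEntry, sum_cellEntry]
  push_cast
  ring

/-! ### Spectral distribution -/

theorem conj_symbolCoeff (j : ℤ × ℤ) (a b : Fin 9) :
    star (symbolCoeff j a b) = symbolCoeff (-j) b a := by
  simp [symbolCoeff, symbolTable_neg]

theorem isHermitian_of_symbolCoeff {m : Type*} {B : Matrix m m ℂ} {ι : m → (ℤ × ℤ) × Fin 9}
    (hB : ∀ x y, B x y = symbolCoeff ((ι x).1 - (ι y).1) (ι x).2 (ι y).2) : B.IsHermitian := by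
  ext x y
  rw [Matrix.conjTranspose_apply, hB, hB, conj_symbolCoeff, neg_sub]

theorem isHermitian_symbolP3 (θ : ℝ × ℝ) : (symbolP3 θ).IsHermitian := by
  rw [symbolP3_eq]
  exact isHermitian_trigPoly_symbolCoeff θ

theorem spectrallyDistributed_toeplitz_symbolP3 :
    SpectrallyDistributed (fun n : ℕ => toeplitz symbolP3 n n) fourierSquare symbolP3 := by
  rw [symbolP3_eq]
  let ι : ∀ n : ℕ, (Fin n × Fin n) × Fin 9 → (ℤ × ℤ) × Fin 9 :=
    fun n x => ((((x.1.1 : ℕ) : ℤ), ((x.1.2 : ℕ) : ℤ)), x.2)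
  have hB : ∀ n x y, toeplitz (trigPoly symbolCoeff) n n x y =
      symbolCoeff ((ι n x).1 - (ι n y).1) (ι n x).2 (ι n y).2 := by
    intro n x y
    have := fourierCoeff₂_trigPoly (c := symbolCoeff) (fun j hj => symbolCoeff_eq_zero hj)
      ((ι n x).1 - (ι n y).1)
    rw [← this]
    rfl
  refine spectrallyDistributed_section (by norm_num) (fun j hj => symbolCoeff_eq_zero hj)
    isHermitian_trigPoly_symbolCoeff (ι := ι) ?_ hB
    (fun n => isHermitian_of_symbolCoeff (hB n)) ?_ ?_ ?_
  · rintro n ⟨⟨a, b⟩, s⟩ ⟨⟨a', b'⟩, s'⟩ h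
    simp only [ι, Prod.mk.injEq, Nat.cast_inj] at h
    exact Prod.ext (Prod.ext (Fin.ext h.1.1) (Fin.ext h.1.2)) h.2
  · intro n w s h1 h2 h3 h4
    refine ⟨((⟨w.1.toNat, by omega⟩, ⟨w.2.toNat, by omega⟩), s), ?_⟩
    simp only [ι]
    exact Prod.ext (Prod.ext (Int.toNat_of_nonneg h1) (Int.toNat_of_nonneg h2)) rfl
  · rintro n ⟨⟨a, b⟩, s⟩
    have := a.2
    have := b.2
    simp only [ι, Finset.mem_product, Finset.mem_Ico]
    omega
  · refine tendsto_const_nhds.congr' ?_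
    filter_upwards [eventually_ne_atTop 0] with n hn
    have : (n : ℂ) ≠ 0 := by exact_mod_cast hn
    simp only [Fintype.card_prod, Fintype.card_fin]
    push_cast
    field_simp

/-- This section omits only labels with position `3` in the last row or column of cells. -/
theorem spectrallyDistributed_stiffness :
    SpectrallyDistributed (fun n : ℕ => (stiffness (fun _ => 1) n).map (fun t : ℝ => (t : ℂ)))
      fourierSquare symbolP3 := by
  rw [symbolP3_eq]
  let ι : ∀ n : ℕ, NodeIndex n → (ℤ × ℤ) × Fin 9 := fun n p => (nodeCell p, nodeKind p)
  have hB : ∀ n x y, (stiffness (fun _ => 1) n).map (fun t : ℝ => (t : ℂ)) x y =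
      symbolCoeff ((ι n x).1 - (ι n y).1) (ι n x).2 (ι n y).2 := by
    intro n x y
    rw [Matrix.map_apply, stiffness_eq_symbolTable]
    simp [symbolCoeff, ι]
  refine spectrallyDistributed_section (by norm_num) (fun j hj => symbolCoeff_eq_zero hj)
    isHermitian_trigPoly_symbolCoeff (ι := ι) ?_ hB
    (fun n => isHermitian_of_symbolCoeff (hB n)) ?_ ?_ ?_
  · rintro n p q h
    simp only [ι, Prod.mk.injEq] at h
    have h' := nodeType_nodeKind p
    rw [h.1, h.2, nodeType_nodeKind q] at h'
    simp only [Prod.mk.injEq, add_left_inj, Nat.cast_inj] at h'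
    exact Prod.ext (Fin.ext h'.1.symm) (Fin.ext h'.2.symm)
  · intro n w s h1 h2 h3 h4
    have hs := s.2
    -- The node with cell `w` and type `s`; its indices stay below `3n - 1` because `w` is not in
    -- the last layer.
    refine ⟨(⟨3 * w.1.toNat + s % 3, by omega⟩, ⟨3 * w.2.toNat + s / 3, by omega⟩), ?_⟩
    refine Prod.ext (Prod.ext ?_ ?_) (Fin.ext ?_)
    · show (((3 * w.1.toNat + s % 3) / 3 : ℕ) : ℤ) = w.1
      omega
    · show (((3 * w.2.toNat + s / 3) / 3 : ℕ) : ℤ) = w.2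
      omega
    · show (3 * w.1.toNat + s % 3) % 3 + 3 * ((3 * w.2.toNat + s / 3) % 3) = s
      omega
  · rintro n ⟨a, b⟩
    have h1 := a.2
    have h2 := b.2
    simp only [ι, nodeCell, Finset.mem_product, Finset.mem_Ico]
    omega
  -- The number of nodes per cell is `(3n - 1)² / n² = (3 - 1/n)²`, with limit `9`.
  · have h1 : Tendsto (fun n : ℕ => (3 - (n : ℂ)⁻¹) ^ 2) atTop (𝓝 ((3 - 0) ^ 2)) :=
      (tendsto_const_nhds.sub (tendsto_inv_atTop_nhds_zero_nat (𝕜 := ℂ))).pow 2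
    have e : ((3 : ℂ) - 0) ^ 2 = ((9 : ℕ) : ℂ) := by norm_num
    rw [e] at h1
    refine h1.congr' ?_
    filter_upwards [eventually_ne_atTop 0] with n hn
    have : (n : ℂ) ≠ 0 := by exact_mod_cast hn
    simp only [Fintype.card_prod, Fintype.card_fin]
    rw [Nat.cast_mul, Nat.cast_sub (by omega)]
    push_cast
    field_simp

end FEM

theorem proposition3p3p2 :
    (∀ θ : ℝ × ℝ, (FEM.symbolP3 θ).IsHermitian) ∧
    FEM.SpectrallyDistributed (fun n : ℕ => FEM.toeplitz FEM.symbolP3 n n)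
      FEM.fourierSquare FEM.symbolP3 ∧
    FEM.SpectrallyDistributed
      (fun n : ℕ => (FEM.stiffness (fun _ => 1) n).map (fun t : ℝ => (t : ℂ)))
      FEM.fourierSquare FEM.symbolP3 :=
  ⟨FEM.isHermitian_symbolP3, FEM.spectrallyDistributed_toeplitz_symbolP3,
    FEM.spectrallyDistributed_stiffness⟩
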